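/- **Setting.** Let $\alpha\in(0,1)$, and let $a:[0,\infty)\to(0,\infty)$ be a function such that, with $\sigma(p):=a(p^2)p$ for $p\in\mathbb R$, one has $\lim_{p\to\infty}\sigma(p)=0$, and * either $a\in C^{2,\alpha}([0,\infty))$ with $2p\,a'(p)+a(p)>0$ for $0\le p<1$, $=0$ for $p=1$, and $<0$ for $p>1$, * or (relaxed form) $a\in C^{2,\alpha}([0,1))\cap C([0,\infty))$ with $2p\,a'(p)+a(p)>0$ for $0\le p<1$, and $\sigma$ is strictly decreasing on $[1,\infty)$. (Hölder conditions are understood on compact subsets.) For each $q\in(0,\sigma(1))$ let $0<p_q^-<1<p_q^+$ be the two solutions of $\sigma(p)=q$. Let $m\ge 0$ be an integer, $\lambda>1$ and $l_0>0$. Put $$\tilde K_\lambda=\{(p,\sigma(p)):|p|\le\lambda\},\qquad \tilde U_\lambda^+=\{(p,q):\sigma(\lambda)<q<\sigma(1),\ p_q^-<p<p_q^+\},\qquad \tilde U_\lambda^-=-\tilde U_\lambda^+,$$ and for $s>0$, $v\in\mathbb R$ define the sets of real $2\times2$ matrices $$K^m_{\lambda,l_0}(s,v)=\left\{\begin{pmatrix}p&l\\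 s^mv&s^mq\end{pmatrix}:(p,q)\in\tilde K_\lambda,\ |l|\le l_0\right\},$$ $$U^m_{\lambda,l_0}(s,v)=\left\{\begin{pmatrix}p&l\\ s^mv&s^mq\end{pmatrix}:(p,q)\in\tilde U^+_\lambda\cup\tilde U^-_\lambda,\ |l|<l_0\right\}.$$ Let $R,T>0$, $0<\delta_0<R/2$ and $J^*_T=(\delta_0,R-\delta_0)\times(0,T)$. A function $\Phi$ is *piecewise $C^1$* in $J_T^*$ if there is a sequence of disjoint open sets $G_i\subset J_T^*$ with $|J_T^*\setminus\bigcup_iG_i|=0$ and $\Phi\in C^1(\overline{G_i})$ for every $i$. Let $W^{1,\infty}_0=W^{1,\infty}\cap W^{1,1}_0$, where $W_0^{1,1}$ is the closure of $C_0^\infty$ in $W^{1,1}$. Let $\Phi^*\in W^{1,\infty}(J^*_T;\mathbb R^2)$ be piecewise $C^1$ in $J_T^*$, and let $\mathcal P^m_{\lambda,l_0}$ be the (possibly empty) set of all $\Phi=(v,\varphi)\in\Phi^*+W^{1,\infty}_0(J^*_T;\mathbb R^2)$ that are piecewise $C^1$ in $J^*_T$ and satisfy $$\nabla\Phi(s,t)=\begin{pmatrix}v_s&v_t\\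 \varphi_s&\varphi_t\end{pmatrix}(s,t)\in K^m_{\lambda,l_0}(s,v(s,t))\cup U^m_{\lambda,l_0}(s,v(s,t))\quad\text{for a.e. }(s,t)\in J^*_T.$$ **Theorem (Density Theorem).** For every $\epsilon>0$, the set $$\mathcal P^m_{\lambda,l_0,\epsilon}=\left\{\Phi=(v,\varphi)\in\mathcal P^m_{\lambda,l_0}:\int_{J^*_T}\operatorname{dist}\bigl(\nabla\Phi(s,t),K^m_{\lambda,l_0}(s,v(s,t))\bigr)\,ds\,dt\le\epsilon\,|J^*_T|\right\}$$ is dense in $\mathcal P^m_{\lambda,l_0}$ with respect to the $L^\infty(J^*_T;\mathbb R^2)$-metric, where $\operatorname{dist}$ is taken in the Hilbert–Schmidt norm. -/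

import Mathlib

open MeasureTheory Set Filter Topology
open scoped ContDiff NNReal ENNReal

namespace PeronaMalik

noncomputable section

/-! ## Sobolev spaces on open subsets of the `(s, t)`-plane -/

section Sobolev

variable {E : Type*} [NormedAddCommGroup E] [NormedSpace ℝ E]

/-- `ψ ∈ C_c^∞(Ω; E)`. -/
def IsTestFunction (Ω : Set (ℝ × ℝ)) (ψ : ℝ × ℝ → E) : Prop :=
  ContDiff ℝ ∞ ψ ∧ HasCompactSupport ψ ∧ tsupport ψ ⊆ Ω

/-- The first weak partial derivatives of `u` on `Ω` are `g 0` (in `s`) and `g 1` (in `t`). -/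
def IsWeakGradient (Ω : Set (ℝ × ℝ)) (u : ℝ × ℝ → E) (g : Fin 2 → ℝ × ℝ → E) : Prop :=
  LocallyIntegrableOn u Ω ∧ (∀ j, LocallyIntegrableOn (g j) Ω) ∧
    ∀ ψ : ℝ × ℝ → ℝ, IsTestFunction Ω ψ →
      (∫ x in Ω, (fderiv ℝ ψ x (1, 0)) • u x = -∫ x in Ω, ψ x • g 0 x) ∧
      (∫ x in Ω, (fderiv ℝ ψ x (0, 1)) • u x = -∫ x in Ω, ψ x • g 1 x)

/-- `u ∈ W^{1,p}(Ω; E)`. -/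
def MemSobolev (p : ℝ≥0∞) (Ω : Set (ℝ × ℝ)) (u : ℝ × ℝ → E) : Prop :=
  MemLp u p (volume.restrict Ω) ∧
    ∃ g : Fin 2 → ℝ × ℝ → E,
      IsWeakGradient Ω u g ∧ ∀ j, MemLp (g j) p (volume.restrict Ω)

/-- `u ∈ W^{1,1}_0(Ω; E)`: `u ∈ W^{1,1}(Ω; E)` is a limit in `W^{1,1}` of functions in
`C_c^∞(Ω; E)`. -/
def MemSobolevOneZero (Ω : Set (ℝ × ℝ)) (u : ℝ × ℝ → E) : Prop :=
  MemLp u 1 (volume.restrict Ω) ∧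
    ∃ g : Fin 2 → ℝ × ℝ → E,
      IsWeakGradient Ω u g ∧ (∀ j, MemLp (g j) 1 (volume.restrict Ω)) ∧
      ∀ η : ℝ, 0 < η → ∃ ψ : ℝ × ℝ → E, IsTestFunction Ω ψ ∧
        eLpNorm (fun x => u x - ψ x) 1 (volume.restrict Ω)
          + eLpNorm (fun x => g 0 x - fderiv ℝ ψ x (1, 0)) 1 (volume.restrict Ω)
          + eLpNorm (fun x => g 1 x - fderiv ℝ ψ x (0, 1)) 1 (volume.restrict Ω)
          < ENNReal.ofReal η

/-- `u ∈ W^{1,∞}_0(Ω; E) = W^{1,∞}(Ω; E) ∩ W^{1,1}_0(Ω; E)`. -/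
def MemSobolevInftyZero (Ω : Set (ℝ × ℝ)) (u : ℝ × ℝ → E) : Prop :=
  MemSobolev ∞ Ω u ∧ MemSobolevOneZero Ω u

/-- `u ∈ C¹(closure G; E)` for an open set `G`: `u` is `C¹` in `G`, and `u` and its derivative
extend continuously to the closure of `G`. -/
def IsC1UpToBoundary (G : Set (ℝ × ℝ)) (u : ℝ × ℝ → E) : Prop :=
  ContDiffOn ℝ 1 u G ∧
    ∃ (w : ℝ × ℝ → E) (D : ℝ × ℝ → (ℝ × ℝ →L[ℝ] E)),
      ContinuousOn w (closure G) ∧ ContinuousOn D (closure G) ∧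
      ∀ x ∈ G, w x = u x ∧ D x = fderiv ℝ u x

/-- `u` is piecewise `C¹` in `Ω`: there are countably many disjoint open subsets `G i` of `Ω`
that cover `Ω` up to a null set, with `u ∈ C¹(closure (G i); E)` for every `i`. -/
def IsPiecewiseC1 (Ω : Set (ℝ × ℝ)) (u : ℝ × ℝ → E) : Prop :=
  ∃ G : ℕ → Set (ℝ × ℝ),
    (∀ i, IsOpen (G i) ∧ G i ⊆ Ω) ∧ Pairwise (fun i j => Disjoint (G i) (G j)) ∧
    volume (Ω \ ⋃ i, G i) = 0 ∧ ∀ i, IsC1UpToBoundary (G i) u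

end Sobolev

/-! ## The diffusivity `a` and the flux `σ` -/

/-- The flux function `σ(p) = a(p²) p`. -/
def flux (a : ℝ → ℝ) (p : ℝ) : ℝ := a (p ^ 2) * p

/-- `a ∈ C^{2,α}(S)` for an interval `S`, with the Hölder condition on compact subsets of `S`. -/
def IsC2Holder (α : ℝ≥0) (a : ℝ → ℝ) (S : Set ℝ) : Prop :=
  ContDiffOn ℝ 2 a S ∧
    ∀ k ⊆ S, IsCompact k → ∃ C : ℝ≥0, HolderOnWith C α (iteratedDerivWithin 2 a S) k

/-- The standing assumptions on the diffusivity `a : [0, ∞) → (0, ∞)` (values of `a` at negative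
arguments play no role). The last field holds the regularity and monotonicity assumptions in
their basic form and, as an alternative, in their relaxed form. -/
structure IsDiffusivity (α : ℝ≥0) (a : ℝ → ℝ) : Prop where
  exponent_pos : 0 < α
  exponent_lt_one : α < 1
  pos : ∀ p, 0 ≤ p → 0 < a p
  tendsto_flux : Tendsto (flux a) atTop (𝓝 0)
  forward : ∀ p, 0 ≤ p → p < 1 → 0 < 2 * p * derivWithin a (Ici 0) p + a p
  shape :
    (IsC2Holder α a (Ici 0) ∧
      2 * 1 * derivWithin a (Ici 0) 1 + a 1 = 0 ∧
      ∀ p, 1 < p → 2 * p * derivWithin a (Ici 0) p + a p < 0) ∨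
    (IsC2Holder α a (Ico 0 1) ∧ ContinuousOn a (Ici 0) ∧ StrictAntiOn (flux a) (Ici 1))

/-! ## The sets of the differential inclusion -/

/-- `K̃_λ = {(p, σ(p)) : |p| ≤ λ}`. -/
def Ktilde (σ : ℝ → ℝ) (lam : ℝ) : Set (ℝ × ℝ) :=
  {x | |x.1| ≤ lam ∧ x.2 = σ x.1}

/-- `Ũ⁺_λ = {(p, q) : σ(λ) < q < σ(1), p⁻_q < p < p⁺_q}`, where `0 < p⁻_q < 1 < p⁺_q` are the
two positive solutions of `σ(p) = q`. -/
def UtildePlus (σ : ℝ → ℝ) (lam : ℝ) : Set (ℝ × ℝ) :=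
  {x | σ lam < x.2 ∧ x.2 < σ 1 ∧
    ∃ pm pp : ℝ, 0 < pm ∧ pm < 1 ∧ 1 < pp ∧ σ pm = x.2 ∧ σ pp = x.2 ∧ pm < x.1 ∧ x.1 < pp}

/-- `Ũ⁻_λ = {(p, q) : (-p, -q) ∈ Ũ⁺_λ}`. -/
def UtildeMinus (σ : ℝ → ℝ) (lam : ℝ) : Set (ℝ × ℝ) :=
  {x | (-x.1, -x.2) ∈ UtildePlus σ lam}

/-- The set `K^m_{λ,l₀}(s, v)` of matrices. -/
def Kset (σ : ℝ → ℝ) (m : ℕ) (lam l₀ s v : ℝ) : Set (Matrix (Fin 2) (Fin 2) ℝ) :=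
  {A | ∃ p q l : ℝ, (p, q) ∈ Ktilde σ lam ∧ |l| ≤ l₀ ∧
    A = !![p, l; s ^ m * v, s ^ m * q]}

/-- The set `U^m_{λ,l₀}(s, v)` of matrices. -/
def Uset (σ : ℝ → ℝ) (m : ℕ) (lam l₀ s v : ℝ) : Set (Matrix (Fin 2) (Fin 2) ℝ) :=
  {A | ∃ p q l : ℝ, (p, q) ∈ UtildePlus σ lam ∪ UtildeMinus σ lam ∧ |l| < l₀ ∧
    A = !![p, l; s ^ m * v, s ^ m * q]}

/-- The Hilbert-Schmidt norm on `2 × 2` matrices. -/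
def hsNorm (A : Matrix (Fin 2) (Fin 2) ℝ) : ℝ := Real.sqrt (∑ i, ∑ j, A i j ^ 2)

/-- `dist(A, K) = inf_{B ∈ K} |A - B|`. -/
def hsDist (A : Matrix (Fin 2) (Fin 2) ℝ) (K : Set (Matrix (Fin 2) (Fin 2) ℝ)) : ℝ :=
  ⨅ B : K, hsNorm (A - B)

/-! ## The admissible class -/

/-- The rectangle `J*_T = (δ₀, R - δ₀) × (0, T)`. -/
def Jstar (R T δ₀ : ℝ) : Set (ℝ × ℝ) := Ioo δ₀ (R - δ₀) ×ˢ Ioo 0 T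

/-- The Jacobian matrix of `Φ = (v, φ)`, with rows `(v_s, v_t)` and `(φ_s, φ_t)`. A piecewise `C¹`
map is classically differentiable almost everywhere. -/
def grad (Φ : ℝ × ℝ → EuclideanSpace ℝ (Fin 2)) (x : ℝ × ℝ) : Matrix (Fin 2) (Fin 2) ℝ :=
  !![fderiv ℝ Φ x (1, 0) 0, fderiv ℝ Φ x (0, 1) 0;
     fderiv ℝ Φ x (1, 0) 1, fderiv ℝ Φ x (0, 1) 1]

/-- The admissible class `P^m_{λ,l₀}` on `Ω` with boundary datum `Φstar`. -/
def admissible (σ : ℝ → ℝ) (m : ℕ) (lam l₀ : ℝ) (Ω : Set (ℝ × ℝ))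
    (Φstar : ℝ × ℝ → EuclideanSpace ℝ (Fin 2)) : Set (ℝ × ℝ → EuclideanSpace ℝ (Fin 2)) :=
  {Φ | MemSobolevInftyZero Ω (fun x => Φ x - Φstar x) ∧
    IsPiecewiseC1 Ω Φ ∧
    ∀ᵐ x ∂(volume.restrict Ω),
      grad Φ x ∈ Kset σ m lam l₀ x.1 (Φ x 0) ∪ Uset σ m lam l₀ x.1 (Φ x 0)}

/-- The subclass `P^m_{λ,l₀,ε}` of all `Φ = (v, φ) ∈ P^m_{λ,l₀}` with
`∫_Ω dist(∇Φ(s,t), K^m_{λ,l₀}(s, v(s,t))) ds dt ≤ ε |Ω|`. -/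
def admissibleEps (σ : ℝ → ℝ) (m : ℕ) (lam l₀ : ℝ) (Ω : Set (ℝ × ℝ))
    (Φstar : ℝ × ℝ → EuclideanSpace ℝ (Fin 2)) (ε : ℝ) :
    Set (ℝ × ℝ → EuclideanSpace ℝ (Fin 2)) :=
  {Φ | Φ ∈ admissible σ m lam l₀ Ω Φstar ∧
    IntegrableOn (fun x => hsDist (grad Φ x) (Kset σ m lam l₀ x.1 (Φ x 0))) Ω ∧
    ∫ x in Ω, hsDist (grad Φ x) (Kset σ m lam l₀ x.1 (Φ x 0)) ≤ ε * volume.real Ω}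

end

end PeronaMalik

open PeronaMalik

/-! Only the set where the gradient of Φ lies in `Uset` needs changing, since almost everywhere else
it already lies in `Kset`. Describe the gradient there by F = (v_s, s⁻ᵐ φ_t, v_t), the fourth entry
being tied by φ_s = sᵐ v. The values of F form part of an open set (`isOpen_openRegion`), and every
point of it lies on a segment in the p-direction, inside that set, whose ends are as close as
desired to the curve (p, σ(p)), |p| ≤ λ (`exists_segment_openRegion`). So v_s should oscillate
rapidly between the two ends while s⁻ᵐ φ_t and v_t hardly move and φ_s = sᵐ v is kept exactly.

The exact constraint comes from a potential. Put f = ρ² s^(m+1) χ(t/L - d) H(s/ρ - c) and w = s⁻ᵐ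
f_s. Then w_s = s χ H'' + O(ρ), w_t = O(ρ/L) and s⁻ᵐ f_t = O(ρ²/L). With ρ = L² everything except s
χ H'' is O(L), including w and f (`cell_bounds`). The profile H is compactly supported, and H''
takes the value -A or a value close to B off a small set (`exists_profile`).

By continuity of F one profile serves a whole neighbourhood (`exists_local_profile`), and finitely
many small cells cover a compact set of almost full measure (`exists_oscillation`). The new gradient
stays in `Uset` on the modified set. It is close to `Kset` off a set of small measure, on which the
distance is still at most 2λ. Since (w, f) is a small test function, the boundary condition,
piecewise smoothness and uniform closeness are preserved. -/

namespace PeronaMalik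

/-! ### One-dimensional profiles and cut-offs -/

/-- A smooth function supported in `[-1/2, 1/2]` together with its first two derivatives. -/
structure Profile where
  H : ℝ → ℝ
  H₁ : ℝ → ℝ
  H₂ : ℝ → ℝ
  smooth : ContDiff ℝ ∞ H
  hasDeriv : ∀ y, HasDerivAt H (H₁ y) y
  hasDeriv₁ : ∀ y, HasDerivAt H₁ (H₂ y) y
  zero : ∀ y, 1 / 2 ≤ |y| → H y = 0
  zero₁ : ∀ y, 1 / 2 ≤ |y| → H₁ y = 0
  zero₂ : ∀ y, 1 / 2 ≤ |y| → H₂ y = 0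

/-- A smooth even function of mean zero supported in `[-1/2, 1/2]` is the second derivative of a
smooth function supported there. -/
theorem exists_profile_of_even {h : ℝ → ℝ} (hs : ContDiff ℝ ∞ h) (heven : ∀ y, h (-y) = h y)
    (hzero : ∀ y, 1 / 2 ≤ |y| → h y = 0) (hint : ∫ y, h y = 0) : ∃ P : Profile, P.H₂ = h := by
  have hc : Continuous h := hs.continuous
  set H₁ : ℝ → ℝ := fun y => ∫ x in (-1 : ℝ)..y, h x with hH₁
  have d₁ : ∀ y, HasDerivAt H₁ (h y) y := fun y => (hc.integral_hasStrictDerivAt _ y).hasDerivAt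
  have hc₁ : Continuous H₁ := continuous_iff_continuousAt.2 fun y => (d₁ y).continuousAt
  set H : ℝ → ℝ := fun y => ∫ x in (-1 : ℝ)..y, H₁ x with hH
  have d : ∀ y, HasDerivAt H (H₁ y) y := fun y => (hc₁.integral_hasStrictDerivAt _ y).hasDerivAt
  have ii : ∀ a b, IntervalIntegrable h volume a b := fun a b => hc.intervalIntegrable a b
  have hfull : ∫ x in (-1 : ℝ)..1, h x = 0 := by
    rw [intervalIntegral.integral_eq_integral_of_support_subset, hint]
    intro y hy
    by_contra hcon
    refine hy (hzero y ?_)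
    rcases lt_or_ge (-1) y with h1 | h1
    · have : 1 < y := by
        by_contra h2
        exact hcon ⟨h1, not_lt.1 h2⟩
      rw [abs_of_pos (by linarith)]; linarith
    · rw [abs_of_neg (by linarith)]; linarith
  -- Mean zero makes the first antiderivative vanish beyond 1/2. Evenness of h makes it odd, hence
  -- itself of mean zero, so the second antiderivative vanishes there too.
  have odd : ∀ y, H₁ (-y) = -H₁ y := by
    intro y
    have h1 : H₁ (-y) = ∫ x in y..1, h x := by
      have := intervalIntegral.integral_comp_neg (a := y) (b := 1) h
      simp only [heven] at this
      rw [this]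
    have h2 : H₁ y + ∫ x in y..1, h x = 0 := by
      rw [hH₁, ← hfull]; exact intervalIntegral.integral_add_adjacent_intervals (ii _ _) (ii _ _)
    linarith
  have z₁' : ∀ y, y ≤ -(1 / 2) → H₁ y = 0 := by
    intro y hy
    rw [hH₁]
    refine (intervalIntegral.integral_congr (g := fun _ => (0 : ℝ)) ?_).trans (by simp)
    intro x hx
    refine hzero x ?_
    have : x ≤ -(1 / 2) := (mem_uIcc.1 hx).elim (fun h => by linarith) (fun h => by linarith)
    rw [abs_of_neg (by linarith)]; linarith
  have z₁ : ∀ y, 1 / 2 ≤ |y| → H₁ y = 0 := by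
    intro y hy
    rcases le_abs.1 hy with h1 | h1
    · have := odd y
      rw [z₁' (-y) (by linarith)] at this
      linarith
    · exact z₁' y (by linarith)
  have z' : ∀ y, y ≤ -(1 / 2) → H y = 0 := by
    intro y hy
    rw [hH]
    refine (intervalIntegral.integral_congr (g := fun _ => (0 : ℝ)) ?_).trans (by simp)
    intro x hx
    exact z₁' x ((mem_uIcc.1 hx).elim (fun h => by linarith) (fun h => by linarith))
  have ev : ∀ y, H (-y) = H y := by
    intro y
    have ii₁ : ∀ a b, IntervalIntegrable H₁ volume a b := fun a b => hc₁.intervalIntegrable a b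
    have flip : ∀ b, ∫ x in (-1 : ℝ)..-b, H₁ x = -∫ x in b..1, H₁ x := by
      intro b
      rw [← intervalIntegral.integral_comp_neg (a := b) (b := 1) H₁, ← intervalIntegral.integral_neg]
      exact intervalIntegral.integral_congr fun x _ => odd x
    have h1 : (∫ x in (-1 : ℝ)..y, H₁ x) + ∫ x in y..1, H₁ x = ∫ x in (-1 : ℝ)..1, H₁ x :=
      intervalIntegral.integral_add_adjacent_intervals (ii₁ _ _) (ii₁ _ _)
    have h2 := flip (-1)
    rw [neg_neg] at h2
    change (∫ x in (-1 : ℝ)..-y, H₁ x) = ∫ x in (-1 : ℝ)..y, H₁ x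
    rw [flip y]
    linarith
  refine ⟨⟨H, H₁, h, ?_, d, d₁, ?_, z₁, hzero⟩, rfl⟩
  · have e : deriv H = H₁ := funext fun y => (d y).deriv
    have e₁ : deriv H₁ = h := funext fun y => (d₁ y).deriv
    rw [contDiff_infty_iff_deriv, e, contDiff_infty_iff_deriv, e₁]
    exact ⟨fun y => (d y).differentiableAt, fun y => (d₁ y).differentiableAt, hs⟩
  · intro y hy
    rcases le_abs.1 hy with h1 | h1
    · rw [← ev]; exact z' _ (by linarith)
    · exact z' y (by linarith)

/-- Smooth cut-offs of `[-1/2, 1/2]`. -/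
theorem exists_cutoff {κ : ℝ} (hκ : 0 < κ) : ∃ χ : ℝ → ℝ, ContDiff ℝ ∞ χ ∧
    (∀ z, 0 ≤ χ z ∧ χ z ≤ 1) ∧ (∀ z, 1 / 2 ≤ |z| → χ z = 0) ∧
    ∃ B : Set ℝ, volume B ≤ ENNReal.ofReal κ ∧
      ∀ z, |z| ≤ 1 / 2 → z ∉ B → χ z = 1 := by
  set η := min (κ / 2) (1 / 4) with hη
  have h0 : 0 < η := lt_min (by linarith) (by norm_num)
  have h1 : η ≤ 1 / 4 := min_le_right _ _
  have h2 : 2 * η ≤ κ := by linarith [min_le_left (κ / 2) (1 / 4)]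
  let β : ContDiffBump (0 : ℝ) := ⟨1 / 2 - η, 1 / 2, by linarith, by linarith⟩
  refine ⟨β, β.contDiff, fun z => ⟨β.nonneg, β.le_one⟩, fun z hz => ?_,
    Icc (1 / 2 - η) (1 / 2) ∪ Icc (-(1 / 2)) (-(1 / 2 - η)), ?_, fun z hz hzB => ?_⟩
  · exact β.zero_of_le_dist (by simpa [β] using hz)
  · refine (measure_union_le _ _).trans ?_
    rw [Real.volume_Icc, Real.volume_Icc, ← ENNReal.ofReal_add (by linarith) (by linarith)]
    exact ENNReal.ofReal_le_ofReal (by linarith)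
  · refine β.one_of_mem_closedBall ?_
    rw [mem_closedBall_zero_iff, Real.norm_eq_abs]
    change |z| ≤ 1 / 2 - η
    by_contra hcon
    push Not at hcon
    refine hzB ?_
    rw [abs_le] at hz
    rcases lt_abs.1 hcon with h | h
    · exact Or.inl ⟨h.le, hz.2⟩
    · exact Or.inr ⟨hz.1, by linarith⟩

/-- Smooth approximations of the second antiderivative of a function with the two values `-A`
and `B`. -/
theorem exists_profile {A B κ τ : ℝ} (hA : 0 < A) (hB : 0 < B) (hκ : 0 < κ) (hτ : 0 < τ) :
    ∃ P : Profile, (∀ y, P.H₂ y ∈ Icc (-A) B) ∧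
    ∃ D : Set ℝ, volume D ≤ ENNReal.ofReal κ ∧
      ∀ y, |y| ≤ 1 / 2 → y ∉ D → P.H₂ y = -A ∨ B - τ ≤ P.H₂ y := by
  -- The fraction of the unit interval that must carry the value B for a function with values -A and
  -- B to have mean zero.
  set θ := A / (A + B) with hθ
  have hθ0 : 0 < θ := by positivity
  have hθ1 : θ < 1 := by rw [hθ, div_lt_one (by positivity)]; linarith
  -- η is the width of the four transition layers: their total length is at most κ, the support of
  -- `β₁` stays inside the plateau of `β₂`, and the height needed for mean zero exceeds A + B - τ.
  obtain ⟨η, ⟨h0, h4, h5, h6⟩⟩ : ∃ η : ℝ, 0 < η ∧ 4 * η ≤ κ ∧ 4 * η < 1 - θ ∧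
      A + B - τ < A * (1 - 2 * η) / (θ + 2 * η) := by
    have e0 : ∀ᶠ η in 𝓝[>] (0 : ℝ), 0 < η := self_mem_nhdsWithin
    have e1 : ∀ᶠ η in 𝓝[>] (0 : ℝ), 4 * η < κ :=
      ((continuous_const.mul continuous_id).tendsto' (0 : ℝ) 0 (by simp)
        |>.eventually_lt_const hκ).filter_mono nhdsWithin_le_nhds
    have e2 : ∀ᶠ η in 𝓝[>] (0 : ℝ), 4 * η < 1 - θ :=
      ((continuous_const.mul continuous_id).tendsto' (0 : ℝ) 0 (by simp)
        |>.eventually_lt_const (by linarith)).filter_mono nhdsWithin_le_nhds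
    have e3 : ∀ᶠ η in 𝓝[>] (0 : ℝ), A + B - τ < A * (1 - 2 * η) / (θ + 2 * η) := by
      have hcont : ContinuousAt (fun η : ℝ => A * (1 - 2 * η) / (θ + 2 * η)) 0 := by
        refine ContinuousAt.div (by fun_prop) (by fun_prop) (by simpa using hθ0.ne')
      have hv : A + B - τ < (fun η : ℝ => A * (1 - 2 * η) / (θ + 2 * η)) 0 := by
        have : A / θ = A + B := by rw [hθ]; field_simp
        simp only [mul_zero, sub_zero, mul_one, add_zero, this]; linarith
      exact (hcont.tendsto.eventually_const_lt hv).filter_mono nhdsWithin_le_nhds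
    obtain ⟨η, a, b, c, d⟩ := (e0.and (e1.and (e2.and e3))).exists
    exact ⟨η, a, b.le, c, d⟩
  let β₁ : ContDiffBump (0 : ℝ) := ⟨θ / 2, θ / 2 + η, by linarith, by linarith⟩
  let β₂ : ContDiffBump (0 : ℝ) := ⟨1 / 2 - η, 1 / 2, by linarith, by linarith⟩
  set I₁ := ∫ y, β₁ y with hI₁
  set I₂ := ∫ y, β₂ y with hI₂
  have b1 : θ ≤ I₁ := by
    have := β₁.measure_closedBall_le_integral volume
    rw [Real.volume_real_closedBall (by positivity)] at this
    change 2 * (θ / 2) ≤ I₁ at this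
    linarith
  have b2 : I₁ ≤ θ + 2 * η := by
    have := β₁.integral_le_measure_closedBall volume
    rw [Real.volume_real_closedBall β₁.rOut_pos.le] at this
    change I₁ ≤ 2 * (θ / 2 + η) at this
    linarith
  have b3 : 1 - 2 * η ≤ I₂ := by
    have := β₂.measure_closedBall_le_integral volume
    rw [Real.volume_real_closedBall β₂.rIn_pos.le] at this
    change 2 * (1 / 2 - η) ≤ I₂ at this
    linarith
  have b4 : I₂ ≤ 1 := by
    have := β₂.integral_le_measure_closedBall volume
    rw [Real.volume_real_closedBall β₂.rOut_pos.le] at this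
    change I₂ ≤ 2 * (1 / 2) at this
    linarith
  have hI₁0 : 0 < I₁ := by linarith
  -- The height of the inner bump is dictated by mean zero; the bounds on `I₁` and `I₂` place it
  -- between A + B - τ and A + B.
  set c := A * I₂ / I₁ with hc
  have hc0 : 0 ≤ c := by
    have : 0 ≤ I₂ := by linarith
    positivity
  have c1 : c ≤ A + B := by
    have : (A + B) * θ = A := by rw [hθ]; field_simp
    rw [hc, div_le_iff₀ hI₁0]
    calc A * I₂ ≤ A * 1 := by gcongr
      _ = (A + B) * θ := by linarith
      _ ≤ (A + B) * I₁ := by gcongr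
  have c2 : A + B - τ ≤ c := by
    refine h6.le.trans ?_
    rw [hc]
    have : 0 ≤ 1 - 2 * η := by linarith
    have : 0 ≤ I₂ := by linarith
    gcongr
  obtain ⟨P, hP⟩ := exists_profile_of_even (h := fun y => c * β₁ y - A * β₂ y)
    ((contDiff_const.mul β₁.contDiff).sub (contDiff_const.mul β₂.contDiff))
    (fun y => by simp only [β₁.neg, β₂.neg])
    (fun y hy => by
      rw [β₁.zero_of_le_dist, β₂.zero_of_le_dist]
      · simp
      · simpa [β₂] using hy
      · rw [dist_zero_right, Real.norm_eq_abs]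
        change θ / 2 + η ≤ |y|
        linarith)
    (by
      rw [integral_sub (β₁.integrable.const_mul c) (β₂.integrable.const_mul A),
        integral_const_mul, integral_const_mul, ← hI₁, ← hI₂, hc]
      field_simp
      ring)
  have one₂ : ∀ y, |y| ≤ 1 / 2 - η → β₂ y = 1 := fun y hy =>
    β₂.one_of_mem_closedBall (by rw [mem_closedBall_zero_iff, Real.norm_eq_abs]; exact hy)
  have one₁ : ∀ y, |y| ≤ θ / 2 → β₁ y = 1 := fun y hy =>
    β₁.one_of_mem_closedBall (by rw [mem_closedBall_zero_iff, Real.norm_eq_abs]; exact hy)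
  have zero₁ : ∀ y, θ / 2 + η ≤ |y| → β₁ y = 0 := fun y hy =>
    β₁.zero_of_le_dist (by rw [dist_zero_right, Real.norm_eq_abs]; exact hy)
  refine ⟨P, fun y => ?_, Icc (-(θ / 2 + η)) (-(θ / 2)) ∪ Icc (θ / 2) (θ / 2 + η) ∪
    (Icc (-(1 / 2)) (-(1 / 2 - η)) ∪ Icc (1 / 2 - η) (1 / 2)),
    ?_, fun y hy hyD => ?_⟩
  · have n1 := β₁.nonneg' y
    have n2 := β₂.nonneg' y
    have l1 := β₁.le_one (x := y)
    have l2 := β₂.le_one (x := y)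
    rw [hP]
    refine ⟨by nlinarith, ?_⟩
    change c * β₁ y - A * β₂ y ≤ B
    -- On the plateau of `β₂` the value is at most c - A ≤ B; off it `β₁` vanishes and the value is
    -- not positive.
    rcases le_total |y| (1 / 2 - η) with h | h
    · rw [one₂ y h]
      nlinarith
    · rw [zero₁ y (by linarith)]
      nlinarith
  · refine ((measure_union_le _ _).trans
      (add_le_add (measure_union_le _ _) (measure_union_le _ _))).trans ?_
    simp only [Real.volume_Icc]
    rw [← ENNReal.ofReal_add (by linarith) (by linarith),
      ← ENNReal.ofReal_add (by linarith) (by linarith),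
      ← ENNReal.ofReal_add (by linarith) (by linarith)]
    exact ENNReal.ofReal_le_ofReal (by linarith)
  · rw [hP]
    change c * β₁ y - A * β₂ y = -A ∨ B - τ ≤ c * β₁ y - A * β₂ y
    simp only [mem_union, not_or, mem_Icc, not_and, not_le] at hyD
    obtain ⟨⟨k1, k2⟩, k3, k4⟩ := hyD
    obtain ⟨y1, y2⟩ := abs_le.1 hy
    have hin : |y| ≤ 1 / 2 - η := by
      refine abs_le.2 ⟨?_, ?_⟩
      · linarith [k3 y1]
      · by_contra hcon
        push Not at hcon
        linarith [k4 hcon.le]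
    rw [one₂ y hin]
    rcases le_total |y| (θ / 2) with h | h
    · right; rw [one₁ y h]; linarith
    · left
      rw [zero₁ y]
      · ring
      · rcases le_abs.1 h with h | h
        · exact (k2 h).le.trans (le_abs_self y)
        · have : y < -(θ / 2 + η) := by
            by_contra hcon
            push Not at hcon
            linarith [k1 hcon]
          exact le_trans (by linarith) (neg_le_abs y)

/-! ### The perturbation in a single cell -/

section Cell

theorem Profile.smooth₁ (P : Profile) : ContDiff ℝ ∞ P.H₁ := by
  have e : deriv P.H = P.H₁ := funext fun y => (P.hasDeriv y).deriv
  rw [← e]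
  exact (contDiff_infty_iff_deriv.1 P.smooth).2

theorem exists_abs_le_of_eq_zero {g : ℝ → ℝ} (hg : Continuous g)
    (h0 : ∀ y, 1 / 2 ≤ |y| → g y = 0) : ∃ M, 0 ≤ M ∧ ∀ y, |g y| ≤ M := by
  obtain ⟨M, hM⟩ := (isCompact_Icc (a := -(1 / 2 : ℝ)) (b := 1 / 2)).exists_bound_of_continuousOn
    hg.continuousOn
  have hM0 : 0 ≤ M := (norm_nonneg _).trans (hM 0 (by norm_num))
  refine ⟨M, hM0, fun y => ?_⟩
  rcases le_total (1 / 2) |y| with h | h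
  · simpa [h0 y h] using hM0
  · exact hM y (abs_le.1 h)

theorem Profile.exists_bound (P : Profile) :
    ∃ M, 0 ≤ M ∧ (∀ y, |P.H y| ≤ M) ∧ ∀ y, |P.H₁ y| ≤ M := by
  obtain ⟨M, h0, hM⟩ := exists_abs_le_of_eq_zero P.smooth.continuous P.zero
  obtain ⟨M₁, h1, hM₁⟩ := exists_abs_le_of_eq_zero P.smooth₁.continuous P.zero₁
  exact ⟨max M M₁, le_max_of_le_left h0, fun y => (hM y).trans (le_max_left _ _),
    fun y => (hM₁ y).trans (le_max_right _ _)⟩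

variable (P : Profile) (χ : ℝ → ℝ) (m : ℕ) (ρ L c d : ℝ) (x : ℝ × ℝ)

/-- The perturbation of `v` in one cell. -/
noncomputable def cellV : ℝ :=
  ρ * χ (x.2 / L - d) * (x.1 * P.H₁ (x.1 / ρ - c) + (m + 1) * ρ * P.H (x.1 / ρ - c))

/-- The perturbation of `φ` in one cell; its `s`-derivative is `s ^ m * cellV`. -/
noncomputable def cellF : ℝ :=
  ρ ^ 2 * x.1 ^ (m + 1) * χ (x.2 / L - d) * P.H (x.1 / ρ - c)

/-- The s-derivative of `cellV`: the term with `P.H₂` is the intended oscillation, the other is an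
error of order ρ. -/
noncomputable def cellVs : ℝ :=
  χ (x.2 / L - d) * (x.1 * P.H₂ (x.1 / ρ - c) + (m + 2) * ρ * P.H₁ (x.1 / ρ - c))

noncomputable def cellVt : ℝ :=
  ρ / L * deriv χ (x.2 / L - d) *
    (x.1 * P.H₁ (x.1 / ρ - c) + (m + 1) * ρ * P.H (x.1 / ρ - c))

/-- `s ^ m * cellQ` is the `t`-derivative of `cellF`. -/
noncomputable def cellQ : ℝ :=
  ρ ^ 2 / L * x.1 * deriv χ (x.2 / L - d) * P.H (x.1 / ρ - c)

variable {χ ρ L}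

theorem hasFDerivAt_div_sub_fst :
    HasFDerivAt (fun x : ℝ × ℝ => x.1 / ρ - c) (ρ⁻¹ • ContinuousLinearMap.fst ℝ ℝ ℝ) x := by
  simpa [div_eq_mul_inv, mul_comm] using
    ((hasFDerivAt_fst (𝕜 := ℝ) (p := x)).const_mul ρ⁻¹).sub_const c

theorem hasFDerivAt_div_sub_snd :
    HasFDerivAt (fun x : ℝ × ℝ => x.2 / L - d) (L⁻¹ • ContinuousLinearMap.snd ℝ ℝ ℝ) x := by
  simpa [div_eq_mul_inv, mul_comm] using
    ((hasFDerivAt_snd (𝕜 := ℝ) (p := x)).const_mul L⁻¹).sub_const d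

theorem contDiff_cellV (hχ : ContDiff ℝ ∞ χ) : ContDiff ℝ ∞ (cellV P χ m ρ L c d) := by
  have h1 := P.smooth
  have h2 := P.smooth₁
  unfold cellV
  fun_prop

theorem contDiff_cellF (hχ : ContDiff ℝ ∞ χ) : ContDiff ℝ ∞ (cellF P χ m ρ L c d) := by
  have h1 := P.smooth
  unfold cellF
  fun_prop

theorem hasFDerivAt_cellV (hχ : ContDiff ℝ ∞ χ) (hρ : ρ ≠ 0) :
    HasFDerivAt (cellV P χ m ρ L c d)
      (cellVs P χ m ρ L c d x • ContinuousLinearMap.fst ℝ ℝ ℝ +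
        cellVt P χ m ρ L c d x • ContinuousLinearMap.snd ℝ ℝ ℝ) x := by
  have hd : HasDerivAt χ (deriv χ (x.2 / L - d)) (x.2 / L - d) :=
    ((hχ.differentiable (by simp)) _).hasDerivAt
  have e1 := hd.comp_hasFDerivAt x (hasFDerivAt_div_sub_snd (L := L) d x)
  have e2 := (P.hasDeriv _).comp_hasFDerivAt x (hasFDerivAt_div_sub_fst (ρ := ρ) c x)
  have e3 := (P.hasDeriv₁ _).comp_hasFDerivAt x (hasFDerivAt_div_sub_fst (ρ := ρ) c x)
  have e4 := (e1.const_mul ρ).mul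
    (((hasFDerivAt_fst (𝕜 := ℝ) (p := x)).mul e3).add (e2.const_mul ((m + 1) * ρ)))
  refine HasFDerivAt.congr_fderiv e4 ?_
  ext
  · simp [cellVs]
    field_simp
    ring
  · simp [cellVt]
    ring

theorem hasFDerivAt_cellF (hχ : ContDiff ℝ ∞ χ) (hρ : ρ ≠ 0) :
    HasFDerivAt (cellF P χ m ρ L c d)
      ((x.1 ^ m * cellV P χ m ρ L c d x) • ContinuousLinearMap.fst ℝ ℝ ℝ +
        (x.1 ^ m * cellQ P χ ρ L c d x) • ContinuousLinearMap.snd ℝ ℝ ℝ) x := by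
  have hd : HasDerivAt χ (deriv χ (x.2 / L - d)) (x.2 / L - d) :=
    ((hχ.differentiable (by simp)) _).hasDerivAt
  have e1 := hd.comp_hasFDerivAt x (hasFDerivAt_div_sub_snd (L := L) d x)
  have e2 := (P.hasDeriv _).comp_hasFDerivAt x (hasFDerivAt_div_sub_fst (ρ := ρ) c x)
  have e3 := (hasDerivAt_pow (m + 1) x.1).comp_hasFDerivAt x (hasFDerivAt_fst (𝕜 := ℝ) (p := x))
  have e4 := (((e3.const_mul (ρ ^ 2))).mul e1).mul e2
  refine HasFDerivAt.congr_fderiv e4 ?_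
  ext
  · simp [cellV]
    field_simp
    ring
  · simp [cellQ]
    ring

/-- A zero of a nonnegative function is a minimum. -/
theorem deriv_eq_zero_of_cutoff (h0 : ∀ z, 0 ≤ χ z) {z : ℝ} (hz : χ z = 0) : deriv χ z = 0 :=
  IsLocalMin.deriv_eq_zero (Eventually.of_forall fun y => by rw [hz]; exact h0 y)

/-- Everything vanishes on and outside the cell boundary, so at each point at most one summand of
the sum over cells survives. -/
theorem cell_eq_zero (h0 : ∀ z, 0 ≤ χ z) (hχ0 : ∀ z, 1 / 2 ≤ |z| → χ z = 0)
    (h : 1 / 2 ≤ |x.1 / ρ - c| ∨ 1 / 2 ≤ |x.2 / L - d|) :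
    cellV P χ m ρ L c d x = 0 ∧ cellF P χ m ρ L c d x = 0 ∧ cellVs P χ m ρ L c d x = 0 ∧
      cellVt P χ m ρ L c d x = 0 ∧ cellQ P χ ρ L c d x = 0 := by
  rcases h with h | h
  · simp [cellV, cellF, cellVs, cellVt, cellQ, P.zero _ h, P.zero₁ _ h, P.zero₂ _ h]
  · have := hχ0 _ h
    simp [cellV, cellF, cellVs, cellVt, cellQ, this, deriv_eq_zero_of_cutoff h0 this]

/-- The choice ρ = L² makes ρ/L = L and ρ²/L = L³, so every quantity except the leading term of
`cellVs` carries a factor L. A single crude constant covers them all. -/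
theorem cell_bounds {S M M' : ℝ} (hχ : ∀ z, 0 ≤ χ z ∧ χ z ≤ 1) (hM' : ∀ z, |deriv χ z| ≤ M')
    (hM : ∀ y, |P.H y| ≤ M) (hM₁ : ∀ y, |P.H₁ y| ≤ M) (hL0 : 0 < L) (hL1 : L ≤ 1)
    (hx0 : 0 < x.1) (hxS : x.1 ≤ S) :
    let E := M * (1 + M') * (S + m + 2 + S ^ (m + 1)) * L
    |cellV P χ m (L ^ 2) L c d x| ≤ E ∧ |cellF P χ m (L ^ 2) L c d x| ≤ E ∧
      |χ (x.2 / L - d) * ((m + 2) * L ^ 2 * P.H₁ (x.1 / L ^ 2 - c))| ≤ E ∧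
      |cellQ P χ (L ^ 2) L c d x| ≤ E ∧ |cellVt P χ m (L ^ 2) L c d x| ≤ E := by
  intro E
  have hM0 : 0 ≤ M := (abs_nonneg _).trans (hM 0)
  have hM'0 : 0 ≤ M' := (abs_nonneg _).trans (hM' 0)
  have hS0 : 0 ≤ S := hx0.le.trans hxS
  have k2 : L ^ 2 ≤ L := by nlinarith
  have k4 : (L ^ 2) ^ 2 ≤ L := by nlinarith
  have hL2 : L ^ 2 ≤ 1 := k2.trans hL1
  have a1 : |χ (x.2 / L - d)| ≤ 1 := abs_le.2 ⟨by linarith [(hχ (x.2 / L - d)).1], (hχ _).2⟩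
  have a2 : |x.1| ≤ S := by rwa [abs_of_pos hx0]
  have a3 : |x.1 * P.H₁ (x.1 / L ^ 2 - c) + (m + 1) * L ^ 2 * P.H (x.1 / L ^ 2 - c)| ≤
      S * M + (m + 1) * 1 * M := by
    refine (abs_add_le _ _).trans (add_le_add ?_ ?_)
    · rw [abs_mul]; gcongr; exact hM₁ _
    · rw [abs_mul, abs_of_nonneg (by positivity : 0 ≤ ((m : ℝ) + 1) * L ^ 2)]; gcongr; exact hM _
  have hP : 0 ≤ S ^ (m + 1) := by positivity
  have hm : (0 : ℝ) ≤ m := by positivity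
  have key : ∀ a b, 0 ≤ a → a ≤ 1 + M' → b ≤ S + m + 2 + S ^ (m + 1) → M * a * b * L ≤ E := by
    intro a b ha hab hb
    calc M * a * b * L ≤ M * a * (S + m + 2 + S ^ (m + 1)) * L := by gcongr
      _ ≤ M * (1 + M') * (S + m + 2 + S ^ (m + 1)) * L := by gcongr
  refine ⟨?_, ?_, ?_, ?_, ?_⟩
  · rw [cellV, abs_mul, abs_mul, abs_of_nonneg (by positivity : 0 ≤ L ^ 2)]
    calc _ ≤ L * 1 * (S * M + (m + 1) * 1 * M) := by gcongr
      _ = M * 1 * (S + m + 1 + 0) * L := by ring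
      _ ≤ E := key _ _ (by linarith) (by linarith) (by linarith)
  · rw [cellF, abs_mul, abs_mul, abs_mul, abs_of_nonneg (by positivity : 0 ≤ (L ^ 2) ^ 2), abs_pow]
    calc _ ≤ L * S ^ (m + 1) * 1 * M := by gcongr; exact hM _
      _ = M * 1 * (0 + S ^ (m + 1)) * L := by ring
      _ ≤ E := key _ _ (by linarith) (by linarith) (by linarith)
  · rw [abs_mul, abs_mul, abs_of_nonneg (by positivity : 0 ≤ ((m : ℝ) + 2) * L ^ 2)]
    calc _ ≤ 1 * ((m + 2) * L * M) := by gcongr; exact hM₁ _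
      _ = M * 1 * (0 + m + 2 + 0) * L := by ring
      _ ≤ E := key _ _ (by linarith) (by linarith) (by linarith)
  · have e : (L ^ 2) ^ 2 / L = L ^ 3 := by field_simp
    have k3 : L ^ 3 ≤ L := by nlinarith
    rw [cellQ, e, abs_mul, abs_mul, abs_mul, abs_of_nonneg (by positivity : 0 ≤ L ^ 3)]
    calc _ ≤ L * S * M' * M := by gcongr; exacts [hM' _, hM _]
      _ = M * (0 + M') * (S + 0 + 0 + 0) * L := by ring
      _ ≤ E := key _ _ (by linarith) (by linarith) (by linarith)
  · have e : L ^ 2 / L = L := by field_simp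
    rw [cellVt, e, abs_mul, abs_mul, abs_of_pos hL0]
    calc _ ≤ L * M' * (S * M + (m + 1) * 1 * M) := by gcongr; exact hM' _
      _ = M * (0 + M') * (S + m + 1 + 0) * L := by ring
      _ ≤ E := key _ _ (by linarith) (by linarith) (by linarith)

end Cell

/-! ### The grid of cells of size L² × L -/

section Grid

/-- The index of the cell of size `L ^ 2 × L` that contains `x`. -/
noncomputable def cellIndex (L : ℝ) (x : ℝ × ℝ) : ℤ × ℤ := (⌊x.1 / L ^ 2⌋, ⌊x.2 / L⌋)

/-- The closed cell with index `k`. -/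
def closedCell (L : ℝ) (k : ℤ × ℤ) : Set (ℝ × ℝ) :=
  {x | |x.1 / L ^ 2 - (k.1 + 1 / 2)| ≤ 1 / 2 ∧ |x.2 / L - (k.2 + 1 / 2)| ≤ 1 / 2}

theorem abs_sub_floor_le (u : ℝ) : |u - (⌊u⌋ + 1 / 2)| ≤ 1 / 2 := by
  rw [abs_le]
  constructor <;> linarith [Int.floor_le u, Int.lt_floor_add_one u]

theorem le_abs_sub_of_floor_ne {u : ℝ} {k : ℤ} (h : ⌊u⌋ ≠ k) : 1 / 2 ≤ |u - (k + 1 / 2)| := by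
  by_contra hcon
  push Not at hcon
  rw [abs_lt] at hcon
  exact h (Int.floor_eq_iff.2 ⟨by linarith, by linarith⟩)

theorem mem_closedCell_cellIndex (L : ℝ) (x : ℝ × ℝ) : x ∈ closedCell L (cellIndex L x) :=
  ⟨abs_sub_floor_le _, abs_sub_floor_le _⟩

theorem le_abs_of_cellIndex_ne {L : ℝ} {x : ℝ × ℝ} {k : ℤ × ℤ} (h : cellIndex L x ≠ k) :
    1 / 2 ≤ |x.1 / L ^ 2 - (k.1 + 1 / 2)| ∨ 1 / 2 ≤ |x.2 / L - (k.2 + 1 / 2)| := by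
  by_cases h1 : ⌊x.1 / L ^ 2⌋ = k.1
  · right
    refine le_abs_sub_of_floor_ne fun h2 => h (Prod.ext h1 h2)
  · exact Or.inl (le_abs_sub_of_floor_ne h1)

theorem isClosed_closedCell (L : ℝ) (k : ℤ × ℤ) : IsClosed (closedCell L k) := by
  have h1 : Continuous fun x : ℝ × ℝ => |x.1 / L ^ 2 - (k.1 + 1 / 2)| := by fun_prop
  have h2 : Continuous fun x : ℝ × ℝ => |x.2 / L - (k.2 + 1 / 2)| := by fun_prop
  exact (isClosed_le h1 continuous_const).inter (isClosed_le h2 continuous_const)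

theorem dist_le_of_mem_closedCell {L : ℝ} (hL0 : 0 < L) (hL1 : L ≤ 1) {k : ℤ × ℤ} {x y : ℝ × ℝ}
    (hx : x ∈ closedCell L k) (hy : y ∈ closedCell L k) : dist x y ≤ L := by
  have key : ∀ {a b r c : ℝ}, 0 < r → r ≤ L → |a / r - c| ≤ 1 / 2 → |b / r - c| ≤ 1 / 2 →
      dist a b ≤ L := by
    intro a b r c hr hrL ha hb
    rw [abs_le] at ha hb
    have h1 : a / r - b / r ≤ 1 := by linarith [ha.2, hb.1]
    have h2 : b / r - a / r ≤ 1 := by linarith [ha.1, hb.2]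
    rw [← sub_div, div_le_one hr] at h1 h2
    rw [Real.dist_eq, abs_le]
    constructor <;> linarith
  rw [Prod.dist_eq]
  exact max_le (key (by positivity) (by nlinarith) hx.1 hy.1) (key hL0 le_rfl hx.2 hy.2)

theorem measurable_cellIndex (L : ℝ) : Measurable (cellIndex L) :=
  ((Int.measurable_floor.comp (measurable_fst.div_const _))).prodMk
    (Int.measurable_floor.comp (measurable_snd.div_const _))

theorem finite_cellIndex_image {L : ℝ} (hL : 0 < L) {K : Set (ℝ × ℝ)} (hK : IsCompact K) :
    (cellIndex L '' K).Finite := by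
  obtain ⟨M, hM⟩ := hK.isBounded.exists_norm_le
  refine ((Set.finite_Icc (⌊-M / L ^ 2⌋) (⌊M / L ^ 2⌋)).prod
    (Set.finite_Icc (⌊-M / L⌋) (⌊M / L⌋))).subset ?_
  rintro _ ⟨x, hx, rfl⟩
  have h := hM x hx
  rw [Prod.norm_def, max_le_iff, Real.norm_eq_abs, Real.norm_eq_abs, abs_le, abs_le] at h
  obtain ⟨⟨h1, h2⟩, h3, h4⟩ := h
  refine ⟨⟨?_, ?_⟩, ?_, ?_⟩ <;> refine Int.floor_le_floor ?_ <;> gcongr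

theorem preimage_cellIndex {L : ℝ} (hL : 0 < L) (k : ℤ × ℤ) :
    cellIndex L ⁻¹' {k} =
      Ico (k.1 * L ^ 2) ((k.1 + 1) * L ^ 2) ×ˢ Ico (k.2 * L) ((k.2 + 1) * L) := by
  ext x
  simp only [mem_preimage, mem_singleton_iff, cellIndex, Prod.ext_iff, Int.floor_eq_iff, mem_prod,
    mem_Ico]
  rw [le_div_iff₀ (by positivity), div_lt_iff₀ (by positivity), le_div_iff₀ hL, div_lt_iff₀ hL]

theorem volume_preimage_cellIndex {L : ℝ} (hL : 0 < L) (k : ℤ × ℤ) :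
    volume (cellIndex L ⁻¹' {k}) = ENNReal.ofReal (L ^ 2) * ENNReal.ofReal L := by
  rw [preimage_cellIndex hL, Measure.volume_eq_prod, Measure.prod_prod, Real.volume_Ico,
    Real.volume_Ico]
  congr 2 <;> ring

theorem volume_preimage_div_sub {r : ℝ} (hr : 0 < r) (c : ℝ) (D : Set ℝ) :
    volume ((fun s : ℝ => s / r - c) ⁻¹' D) = ENNReal.ofReal r * volume D := by
  have e : (fun s : ℝ => s / r - c) ⁻¹' D = (· * r⁻¹) ⁻¹' ((· + -c) ⁻¹' D) := by
    ext s
    simp [div_eq_mul_inv, sub_eq_add_neg]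
  rw [e, Real.volume_preimage_mul_right (inv_ne_zero hr.ne'), measure_preimage_add_right, inv_inv,
    abs_of_pos hr]

/-- The bad part of a cell lies in the union of two products, one with an exceptional set of
s-values and one with an exceptional set of t-values; each takes up at most the fraction κ of the
cell. -/
theorem volume_bad_cell_le {L κ : ℝ} (hL : 0 < L) (hκ : 0 ≤ κ) (k : ℤ × ℤ) (c d : ℝ)
    {D B : Set ℝ} (hD : volume D ≤ ENNReal.ofReal κ) (hB : volume B ≤ ENNReal.ofReal κ) :
    volume {x | cellIndex L x = k ∧ (x.1 / L ^ 2 - c ∈ D ∨ x.2 / L - d ∈ B)} ≤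
      ENNReal.ofReal (2 * κ) * volume (cellIndex L ⁻¹' {k}) := by
  have hsub : {x | cellIndex L x = k ∧ (x.1 / L ^ 2 - c ∈ D ∨ x.2 / L - d ∈ B)} ⊆
      ((fun s : ℝ => s / L ^ 2 - c) ⁻¹' D) ×ˢ Ico (k.2 * L) ((k.2 + 1) * L) ∪
        Ico (k.1 * L ^ 2) ((k.1 + 1) * L ^ 2) ×ˢ ((fun t : ℝ => t / L - d) ⁻¹' B) := by
    rintro x ⟨h1, h2⟩
    have h1 : x ∈ cellIndex L ⁻¹' {k} := h1
    rw [preimage_cellIndex hL] at h1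
    exact h2.imp (fun h => ⟨h, h1.2⟩) fun h => ⟨h1.1, h⟩
  refine (measure_mono hsub).trans ((measure_union_le _ _).trans ?_)
  rw [volume_preimage_cellIndex hL, Measure.volume_eq_prod, Measure.prod_prod, Measure.prod_prod,
    volume_preimage_div_sub (by positivity), volume_preimage_div_sub hL, Real.volume_Ico,
    Real.volume_Ico, show ((k.2 : ℝ) + 1) * L - k.2 * L = L by ring,
    show ((k.1 : ℝ) + 1) * L ^ 2 - k.1 * L ^ 2 = L ^ 2 by ring, two_mul,
    ENNReal.ofReal_add hκ hκ, add_mul]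
  refine add_le_add ?_ ?_
  · calc _ ≤ ENNReal.ofReal (L ^ 2) * ENNReal.ofReal κ * ENNReal.ofReal L := by gcongr
      _ = _ := by ring
  · calc _ ≤ ENNReal.ofReal (L ^ 2) * (ENNReal.ofReal L * ENNReal.ofReal κ) := by gcongr
      _ = _ := by ring

end Grid

/-! ### Gluing the cells into an oscillation on an open set -/

/-- A tube lemma: the segment is compact and W is open, so membership survives small changes of the
base point and a small added error. -/
theorem eventually_segment_mem {V : Set (ℝ × ℝ)} (hV : IsOpen V) {F : ℝ × ℝ → ℝ × ℝ × ℝ}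
    (hF : ContinuousOn F V) {W : Set (ℝ × ℝ × ℝ)} (hW : IsOpen W) {I : Set ℝ} (hI : IsCompact I)
    {x₀ : ℝ × ℝ} (hx₀ : x₀ ∈ V) (h : ∀ y ∈ I, F x₀ + (x₀.1 * y, 0, 0) ∈ W) :
    ∀ᶠ p : (ℝ × ℝ) × (ℝ × ℝ × ℝ) in 𝓝 (x₀, 0), ∀ y ∈ I, F p.1 + (p.1.1 * y, 0, 0) + p.2 ∈ W := by
  refine hI.eventually_forall_of_forall_eventually fun y hy => ?_
  have hF0 : ContinuousAt F x₀ := hF.continuousAt (hV.mem_nhds hx₀)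
  have hc : ContinuousAt (fun q : ((ℝ × ℝ) × (ℝ × ℝ × ℝ)) × ℝ =>
      F q.1.1 + ((q.1.1.1 * q.2, 0, 0) : ℝ × ℝ × ℝ) + q.1.2) ((x₀, 0), y) := by
    have h1 : ContinuousAt (fun q : ((ℝ × ℝ) × (ℝ × ℝ × ℝ)) × ℝ => F q.1.1) ((x₀, 0), y) :=
      ContinuousAt.comp (g := F) (f := fun q : ((ℝ × ℝ) × (ℝ × ℝ × ℝ)) × ℝ => q.1.1) hF0
        (by fun_prop)
    have h2 : ContinuousAt (fun q : ((ℝ × ℝ) × (ℝ × ℝ × ℝ)) × ℝ =>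
        ((q.1.1.1 * q.2, 0, 0) : ℝ × ℝ × ℝ)) ((x₀, 0), y) := by fun_prop
    exact (h1.add h2).add (by fun_prop)
  refine hc.eventually_mem (hW.mem_nhds ?_)
  simpa using h y hy

/-- The profile is built for the segment at x₀ and reused nearby. The factor θ stands for the values
of the cut-off χ; since -A < 0 < B, multiplication by θ keeps the values of `P.H₂` in [-A, B]. -/
theorem exists_local_profile {V : Set (ℝ × ℝ)} (hV : IsOpen V) {F : ℝ × ℝ → ℝ × ℝ × ℝ}
    (hF : ContinuousOn F V) {W N : Set (ℝ × ℝ × ℝ)} (hW : IsOpen W) (hN : IsOpen N)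
    {x₀ : ℝ × ℝ} (hx₀ : x₀ ∈ V) {A B : ℝ} (hA : 0 < A) (hB : 0 < B)
    (hseg : ∀ h ∈ Icc (-A) B, F x₀ + (x₀.1 * h, 0, 0) ∈ W)
    (hNA : F x₀ + (x₀.1 * -A, 0, 0) ∈ N) (hNB : F x₀ + (x₀.1 * B, 0, 0) ∈ N)
    {κ : ℝ} (hκ : 0 < κ) :
    ∃ (P : Profile) (D : Set ℝ) (r : ℝ), volume D ≤ ENNReal.ofReal κ ∧ 0 < r ∧
      Metric.ball x₀ r ⊆ V ∧ ∀ x ∈ Metric.ball x₀ r, ∀ e : ℝ × ℝ × ℝ, ‖e‖ < r → ∀ y : ℝ,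
        (∀ θ ∈ Icc (0 : ℝ) 1, F x + (x.1 * (θ * P.H₂ y), 0, 0) + e ∈ W) ∧
        (|y| ≤ 1 / 2 → y ∉ D → F x + (x.1 * P.H₂ y, 0, 0) + e ∈ N) := by
  obtain ⟨τ, hτ, hBτ⟩ : ∃ τ > 0, ∀ h ∈ Icc (B - τ) B, F x₀ + (x₀.1 * h, 0, 0) ∈ N := by
    have hc : ContinuousAt (fun h : ℝ => F x₀ + ((x₀.1 * h, 0, 0) : ℝ × ℝ × ℝ)) B := by fun_prop
    obtain ⟨τ, hτ, hb⟩ := Metric.eventually_nhds_iff.1 (hc.eventually_mem (hN.mem_nhds hNB))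
    refine ⟨τ / 2, by positivity, fun h hh => hb ?_⟩
    rw [Real.dist_eq, abs_lt]
    constructor <;> linarith [hh.1, hh.2]
  obtain ⟨P, hP, D, hD, hPD⟩ := exists_profile hA hB hκ hτ
  have e1 := eventually_segment_mem hV hF hW isCompact_Icc hx₀ hseg
  have e2 := eventually_segment_mem hV hF hN (isCompact_singleton (x := -A)) hx₀
    (by rintro _ rfl; exact hNA)
  have e3 := eventually_segment_mem hV hF hN isCompact_Icc hx₀ hBτ
  have e4 : ∀ᶠ p : (ℝ × ℝ) × (ℝ × ℝ × ℝ) in 𝓝 (x₀, 0), p.1 ∈ V :=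
    continuousAt_fst.eventually_mem (hV.mem_nhds hx₀)
  obtain ⟨r, hr, hball⟩ := Metric.eventually_nhds_iff.1 (e1.and (e2.and (e3.and e4)))
  have hmem : ∀ x ∈ Metric.ball x₀ r, ∀ e : ℝ × ℝ × ℝ, ‖e‖ < r →
      dist (x, e) ((x₀, 0) : (ℝ × ℝ) × (ℝ × ℝ × ℝ)) < r := by
    intro x hx e he
    rw [Prod.dist_eq, max_lt_iff]
    exact ⟨hx, by simpa using he⟩
  refine ⟨P, D, r, hD, hr, fun x hx => (hball (hmem x hx 0 (by simpa using hr))).2.2.2,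
    fun x hx e he y => ?_⟩
  obtain ⟨f1, f2, f3, -⟩ := hball (hmem x hx e he)
  refine ⟨fun θ hθ => f1 _ ?_, fun hy hyD => ?_⟩
  · have := hP y
    constructor <;> nlinarith [hθ.1, hθ.2, this.1, this.2]
  · rcases hPD y hy hyD with h | h
    · exact f2 _ h
    · exact f3 _ ⟨h, (hP y).2⟩

/-- Oscillations in the direction of `s` that preserve the relation `f_s = s ^ m w`. -/
theorem exists_oscillation {V : Set (ℝ × ℝ)} (hV : IsOpen V) (hVfin : volume V ≠ ⊤) (m : ℕ)
    {S : ℝ} (hS : ∀ x ∈ V, 0 < x.1 ∧ x.1 ≤ S) {F : ℝ × ℝ → ℝ × ℝ × ℝ} (hF : ContinuousOn F V)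
    {W N : Set (ℝ × ℝ × ℝ)} (hW : IsOpen W) (hN : IsOpen N)
    (hseg : ∀ x ∈ V, ∃ A B : ℝ, 0 < A ∧ 0 < B ∧
      (∀ h ∈ Icc (-A) B, F x + (x.1 * h, 0, 0) ∈ W) ∧
      F x + (x.1 * -A, 0, 0) ∈ N ∧ F x + (x.1 * B, 0, 0) ∈ N)
    {δ : ℝ} (hδ : 0 < δ) :
    ∃ (w f ws wt q : ℝ × ℝ → ℝ) (C bad : Set (ℝ × ℝ)),
      ContDiff ℝ ∞ w ∧ ContDiff ℝ ∞ f ∧ IsCompact C ∧ C ⊆ V ∧ (∀ x ∉ C, w x = 0 ∧ f x = 0) ∧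
      (∀ x, |w x| ≤ δ ∧ |f x| ≤ δ) ∧
      (∀ x, HasFDerivAt w
        (ws x • ContinuousLinearMap.fst ℝ ℝ ℝ + wt x • ContinuousLinearMap.snd ℝ ℝ ℝ) x ∧
        HasFDerivAt f ((x.1 ^ m * w x) • ContinuousLinearMap.fst ℝ ℝ ℝ +
          (x.1 ^ m * q x) • ContinuousLinearMap.snd ℝ ℝ ℝ) x) ∧
      (∀ x ∈ V, F x + (ws x, q x, wt x) ∈ W) ∧
      volume bad ≤ ENNReal.ofReal δ ∧ ∀ x ∈ V \ bad, F x + (ws x, q x, wt x) ∈ N := by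
  classical
  -- Bad parts of cells occupy at most the fraction 2κ of V, hence measure at most δ/2; the summand
  -- 1 avoids division by zero.
  set κ : ℝ := δ / (4 * (volume.real V + 1)) with hκdef
  have hv0 : 0 ≤ volume.real V := measureReal_nonneg
  have hκ : 0 < κ := by positivity
  have hκV : 2 * κ * volume.real V ≤ δ / 2 := by
    rw [hκdef, mul_div_assoc', div_mul_eq_mul_div, div_le_iff₀ (by positivity)]
    nlinarith
  obtain ⟨χ, hχs, hχ, hχ0, BZ, hBZ, hχ1⟩ := exists_cutoff hκ
  obtain ⟨M', -, hM'⟩ := exists_abs_le_of_eq_zero (g := deriv χ)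
    ((contDiff_infty_iff_deriv.1 hχs).2.continuous)
    fun z hz => deriv_eq_zero_of_cutoff (fun z => (hχ z).1) (hχ0 z hz)
  have : Nonempty Profile := ⟨(exists_profile one_pos one_pos one_pos one_pos).choose⟩
  have hloc : ∀ x₀ ∈ V, ∃ (P : Profile) (D : Set ℝ) (r : ℝ), volume D ≤ ENNReal.ofReal κ ∧
      0 < r ∧ Metric.ball x₀ r ⊆ V ∧ ∀ x ∈ Metric.ball x₀ r, ∀ e : ℝ × ℝ × ℝ, ‖e‖ < r → ∀ y : ℝ,
        (∀ θ ∈ Icc (0 : ℝ) 1, F x + (x.1 * (θ * P.H₂ y), 0, 0) + e ∈ W) ∧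
        (|y| ≤ 1 / 2 → y ∉ D → F x + (x.1 * P.H₂ y, 0, 0) + e ∈ N) := by
    intro x₀ hx₀
    obtain ⟨A, B, hA, hB, h1, h2, h3⟩ := hseg x₀ hx₀
    exact exists_local_profile hV hF hW hN hx₀ hA hB h1 h2 h3 hκ
  choose! P D r hD hr hrV hPW using hloc
  choose M _ hM hM₁ using fun x₀ => (P x₀).exists_bound
  obtain ⟨K, hKV, hK, hKδ⟩ := hV.measurableSet.exists_isCompact_sdiff_lt hVfin
    (ε := ENNReal.ofReal (δ / 2)) (by simpa using hδ)
  obtain ⟨I, hIK, hKI⟩ := hK.elim_nhds_subcover (fun x₀ => Metric.ball x₀ (r x₀))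
    fun x hx => Metric.ball_mem_nhds x (hr x (hKV hx))
  have hIV : ∀ i ∈ I, i ∈ V := fun i hi => hKV (hIK i hi)
  -- A cell meeting K has diameter at most L in the max metric, so L < δ₀ places it inside a single
  -- ball, on which one profile works.
  obtain ⟨δ₀, hδ₀, hleb⟩ := lebesgue_number_lemma_of_metric (ι := I)
    (c := fun i => Metric.ball i.1 (r i.1)) hK (fun i => Metric.isOpen_ball)
    (by simpa [iUnion_subtype] using hKI)
  set E : ℝ × ℝ → ℝ := fun i => M i * (1 + M') * (S + m + 2 + S ^ (m + 1)) with hE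
  obtain ⟨L, hL0, hL1, hLδ, hLE⟩ : ∃ L : ℝ, 0 < L ∧ L ≤ 1 ∧ L < δ₀ ∧
      ∀ i ∈ I, E i * L < r i ∧ E i * L < δ := by
    have e0 : ∀ᶠ L in 𝓝[>] (0 : ℝ), 0 < L := self_mem_nhdsWithin
    have e1 : ∀ᶠ L in 𝓝[>] (0 : ℝ), L < 1 := (eventually_lt_nhds one_pos).filter_mono inf_le_left
    have e2 : ∀ᶠ L in 𝓝[>] (0 : ℝ), L < δ₀ := (eventually_lt_nhds hδ₀).filter_mono inf_le_left
    have e3 : ∀ᶠ L in 𝓝[>] (0 : ℝ), ∀ i ∈ I, E i * L < r i ∧ E i * L < δ := by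
      rw [Filter.eventually_all_finset]
      intro i hi
      have hc : Tendsto (fun L => E i * L) (𝓝[>] (0 : ℝ)) (𝓝 0) :=
        ((continuous_const.mul continuous_id).tendsto' (0 : ℝ) 0 (by simp)).mono_left inf_le_left
      exact (hc.eventually_lt_const (hr i (hIV i hi))).and (hc.eventually_lt_const hδ)
    obtain ⟨L, a, b, c, d⟩ := (e0.and (e1.and (e2.and e3))).exists
    exact ⟨L, a, b.le, c, d⟩
  set J : Finset (ℤ × ℤ) := (finite_cellIndex_image hL0 hK).toFinset with hJ
  have hJmem : ∀ k, k ∈ J ↔ ∃ x ∈ K, cellIndex L x = k := by simp [hJ]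
  have hcell : ∀ k ∈ J, ∃ i ∈ I, closedCell L k ⊆ Metric.ball i (r i) := by
    intro k hk
    obtain ⟨x, hxK, rfl⟩ := (hJmem k).1 hk
    obtain ⟨i, hi⟩ := hleb x hxK
    refine ⟨i.1, i.2, fun y hy => hi ?_⟩
    exact (dist_le_of_mem_closedCell hL0 hL1 hy (mem_closedCell_cellIndex L x)).trans_lt hLδ
  choose! τ hτI hτ using hcell
  have hcellV : ∀ k ∈ J, closedCell L k ⊆ V := fun k hk =>
    (hτ k hk).trans (hrV _ (hIV _ (hτI k hk)))
  have hρ : L ^ 2 ≠ 0 := by positivity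
  -- the sum over all cells reduces to one term
  have hsum : ∀ (g : ℤ × ℤ → ℝ) (x : ℝ × ℝ), (∀ k, cellIndex L x ≠ k → g k = 0) →
      ∑ k ∈ J, g k = if cellIndex L x ∈ J then g (cellIndex L x) else 0 := by
    intro g x hg
    split_ifs with h
    · exact Finset.sum_eq_single_of_mem _ h fun k _ hk => hg k hk.symm
    · exact Finset.sum_eq_zero fun k hk => hg k fun hk' => h (hk' ▸ hk)
  have hz : ∀ (k : ℤ × ℤ) (x : ℝ × ℝ), cellIndex L x ≠ k → _ := fun k x hk =>
    cell_eq_zero (P (τ k)) m (k.1 + 1 / 2) (k.2 + 1 / 2) x (fun z => (hχ z).1) hχ0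
      (le_abs_of_cellIndex_ne hk)
  have hbd : ∀ x, cellIndex L x ∈ J → _ := fun x hx =>
    have hxV := hcellV _ hx (mem_closedCell_cellIndex L x)
    cell_bounds (P (τ (cellIndex L x))) m ((cellIndex L x).1 + 1 / 2) ((cellIndex L x).2 + 1 / 2) x
      hχ hM' (hM _) (hM₁ _) hL0 hL1 (hS x hxV).1 (hS x hxV).2
  set w : ℝ × ℝ → ℝ := fun x =>
    ∑ k ∈ J, cellV (P (τ k)) χ m (L ^ 2) L (k.1 + 1 / 2) (k.2 + 1 / 2) x with hw
  set f : ℝ × ℝ → ℝ := fun x =>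
    ∑ k ∈ J, cellF (P (τ k)) χ m (L ^ 2) L (k.1 + 1 / 2) (k.2 + 1 / 2) x with hf
  set ws : ℝ × ℝ → ℝ := fun x =>
    ∑ k ∈ J, cellVs (P (τ k)) χ m (L ^ 2) L (k.1 + 1 / 2) (k.2 + 1 / 2) x with hws
  set wt : ℝ × ℝ → ℝ := fun x =>
    ∑ k ∈ J, cellVt (P (τ k)) χ m (L ^ 2) L (k.1 + 1 / 2) (k.2 + 1 / 2) x with hwt
  set q : ℝ × ℝ → ℝ := fun x =>
    ∑ k ∈ J, cellQ (P (τ k)) χ (L ^ 2) L (k.1 + 1 / 2) (k.2 + 1 / 2) x with hq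
  have hwx := fun x => hsum _ x fun k hk => (hz k x hk).1
  have hfx := fun x => hsum _ x fun k hk => (hz k x hk).2.1
  have hwsx := fun x => hsum _ x fun k hk => (hz k x hk).2.2.1
  have hwtx := fun x => hsum _ x fun k hk => (hz k x hk).2.2.2.1
  have hqx := fun x => hsum _ x fun k hk => (hz k x hk).2.2.2.2
  set badCell : ℤ × ℤ → Set (ℝ × ℝ) := fun k => {x | cellIndex L x = k ∧
    (x.1 / L ^ 2 - (k.1 + 1 / 2) ∈ D (τ k) ∨ x.2 / L - (k.2 + 1 / 2) ∈ BZ)} with hbadCell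
  -- the value in an active cell
  have hval : ∀ x, cellIndex L x ∈ J → ∃ e : ℝ × ℝ × ℝ, ‖e‖ < r (τ (cellIndex L x)) ∧
      F x + (ws x, q x, wt x) = F x + (x.1 * (χ (x.2 / L - ((cellIndex L x).2 + 1 / 2)) *
        (P (τ (cellIndex L x))).H₂ (x.1 / L ^ 2 - ((cellIndex L x).1 + 1 / 2))), 0, 0) + e := by
    intro x hx
    obtain ⟨-, -, b3, b4, b5⟩ := hbd x hx
    have hr' := (hLE _ (hτI _ hx)).1
    refine ⟨(χ (x.2 / L - ((cellIndex L x).2 + 1 / 2)) * ((m + 2) * L ^ 2 *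
        (P (τ (cellIndex L x))).H₁ (x.1 / L ^ 2 - ((cellIndex L x).1 + 1 / 2))),
      cellQ (P (τ (cellIndex L x))) χ (L ^ 2) L ((cellIndex L x).1 + 1 / 2)
        ((cellIndex L x).2 + 1 / 2) x,
      cellVt (P (τ (cellIndex L x))) χ m (L ^ 2) L ((cellIndex L x).1 + 1 / 2)
        ((cellIndex L x).2 + 1 / 2) x), ?_, ?_⟩
    rotate_left
    · rw [add_assoc]
      congr 1
      simp only [hws, hq, hwt]
      rw [hwsx, hqx, hwtx, if_pos hx, if_pos hx, if_pos hx, cellVs, Prod.mk_add_mk,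
        Prod.mk_add_mk, zero_add, zero_add]
      refine Prod.ext ?_ rfl
      dsimp only
      ring
    · rw [Prod.norm_def, Prod.norm_def, max_lt_iff, max_lt_iff]
      exact ⟨b3.trans_lt hr', b4.trans_lt hr', b5.trans_lt hr'⟩
  -- The bad set consists of the part of V missed by K and, in each active cell, the transition
  -- layers of the profile and of the cut-off.
  refine ⟨w, f, ws, wt, q, ⋃ k ∈ J, closedCell L k, (V \ K) ∪ ⋃ k ∈ J, badCell k,
    ContDiff.sum fun k _ => contDiff_cellV _ _ _ _ hχs,
    ContDiff.sum fun k _ => contDiff_cellF _ _ _ _ hχs, ?_, iUnion₂_subset hcellV, ?_, ?_, ?_, ?_,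
    ?_, ?_⟩
  · refine J.isCompact_biUnion fun k hk => ?_
    exact Metric.isCompact_of_isClosed_isBounded (isClosed_closedCell L k)
      (Metric.isBounded_ball.subset (hτ k hk))
  · intro x hx
    have : cellIndex L x ∉ J := fun h => hx (mem_biUnion h (mem_closedCell_cellIndex L x))
    exact ⟨by rw [hw]; exact (hwx x).trans (if_neg this),
      by rw [hf]; exact (hfx x).trans (if_neg this)⟩
  · intro x
    have e1 := hwx x
    have e2 := hfx x
    by_cases h : cellIndex L x ∈ J
    · rw [if_pos h] at e1 e2
      obtain ⟨b1, b2, -⟩ := hbd x h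
      have := (hLE _ (hτI _ h)).2.le
      simp only [hw, hf, e1, e2]
      exact ⟨b1.trans this, b2.trans this⟩
    · rw [if_neg h] at e1 e2
      simp only [hw, hf, e1, e2, abs_zero]
      exact ⟨hδ.le, hδ.le⟩
  · intro x
    constructor
    · have := HasFDerivAt.fun_sum fun k (_ : k ∈ J) =>
        hasFDerivAt_cellV (P (τ k)) m (k.1 + 1 / 2) (k.2 + 1 / 2) x (L := L) hχs hρ
      refine this.congr_fderiv ?_
      rw [Finset.sum_add_distrib, ← Finset.sum_smul, ← Finset.sum_smul]
    · have := HasFDerivAt.fun_sum fun k (_ : k ∈ J) =>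
        hasFDerivAt_cellF (P (τ k)) m (k.1 + 1 / 2) (k.2 + 1 / 2) x (L := L) hχs hρ
      refine this.congr_fderiv ?_
      rw [Finset.sum_add_distrib, ← Finset.sum_smul, ← Finset.sum_smul, ← Finset.mul_sum,
        ← Finset.mul_sum]
  · intro x hx
    by_cases h : cellIndex L x ∈ J
    · obtain ⟨e, he, heq⟩ := hval x h
      rw [heq]
      exact (hPW _ (hIV _ (hτI _ h)) x (hτ _ h (mem_closedCell_cellIndex L x)) e he _).1 _ (hχ _)
    -- Outside the active cells the perturbation vanishes, and F x itself is the point h = 0 of its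
    -- segment.
    · obtain ⟨A, B, hA, hB, h1, -⟩ := hseg x hx
      have e1 := hwsx x
      have e2 := hqx x
      have e3 := hwtx x
      rw [if_neg h] at e1 e2 e3
      simp only [hws, hq, hwt, e1, e2, e3]
      simpa using h1 0 ⟨by linarith, hB.le⟩
  · have hvol : volume (⋃ k ∈ J, badCell k) ≤ ENNReal.ofReal (2 * κ) * volume V := by
      calc volume (⋃ k ∈ J, badCell k) ≤ ∑ k ∈ J, volume (badCell k) :=
            measure_biUnion_finset_le _ _
        _ ≤ ∑ k ∈ J, ENNReal.ofReal (2 * κ) * volume (cellIndex L ⁻¹' {k}) :=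
            Finset.sum_le_sum fun k hk => volume_bad_cell_le hL0 hκ.le k _ _
              (hD _ (hIV _ (hτI k hk))) hBZ
        _ = ENNReal.ofReal (2 * κ) * volume (⋃ k ∈ J, cellIndex L ⁻¹' {k}) := by
            rw [← Finset.mul_sum, measure_biUnion_finset]
            · intro k _ k' _ hkk'
              exact Disjoint.preimage _ (disjoint_singleton.2 hkk')
            · exact fun k _ => measurable_cellIndex L (measurableSet_singleton k)
        _ ≤ ENNReal.ofReal (2 * κ) * volume V := by
            gcongr
            refine iUnion₂_subset fun k hk x hx => hcellV k hk ?_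
            have hx : cellIndex L x = k := hx
            exact hx ▸ mem_closedCell_cellIndex L x
    have hvol2 : ENNReal.ofReal (2 * κ) * volume V ≤ ENNReal.ofReal (δ / 2) := by
      rw [← ofReal_measureReal hVfin, ← ENNReal.ofReal_mul (by positivity)]
      exact ENNReal.ofReal_le_ofReal hκV
    calc _ ≤ ENNReal.ofReal (δ / 2) + ENNReal.ofReal (δ / 2) :=
          (measure_union_le _ _).trans (add_le_add hKδ.le (hvol.trans hvol2))
      _ = ENNReal.ofReal δ := by
          rw [← ENNReal.ofReal_add (by positivity) (by positivity), add_halves]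
  · rintro x ⟨hxV, hx⟩
    rw [mem_union, not_or] at hx
    have hxK : x ∈ K := by
      by_contra h
      exact hx.1 ⟨hxV, h⟩
    have h : cellIndex L x ∈ J := (hJmem _).2 ⟨x, hxK, rfl⟩
    have hxb : x ∉ badCell (cellIndex L x) := fun hb => hx.2 (mem_biUnion h hb)
    have hxb' : x.1 / L ^ 2 - ((cellIndex L x).1 + 1 / 2) ∉ D (τ (cellIndex L x)) ∧
        x.2 / L - ((cellIndex L x).2 + 1 / 2) ∉ BZ := by
      rw [← not_or]
      exact fun hh => hxb ⟨rfl, hh⟩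
    obtain ⟨e, he, heq⟩ := hval x h
    have hc := mem_closedCell_cellIndex L x
    rw [heq, hχ1 _ hc.2 hxb'.2, one_mul]
    exact (hPW _ (hIV _ (hτI _ h)) x (hτ _ h hc) e he _).2 hc.1 hxb'.1

/-! ### Stability of the function classes under adding test functions -/

section Sobolev

variable {E : Type*} [NormedAddCommGroup E] [NormedSpace ℝ E] {Ω : Set (ℝ × ℝ)}
  {u g : ℝ × ℝ → E}

theorem IsTestFunction.continuous_fderiv_apply (hg : IsTestFunction Ω g) (v : ℝ × ℝ) :
    Continuous fun x => fderiv ℝ g x v :=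
  (hg.1.continuous_fderiv (by simp)).clm_apply continuous_const

theorem IsTestFunction.hasCompactSupport_fderiv_apply (hg : IsTestFunction Ω g) (v : ℝ × ℝ) :
    HasCompactSupport fun x => fderiv ℝ g x v :=
  hg.2.1.fderiv_apply (𝕜 := ℝ) v

theorem IsTestFunction.memLp (hg : IsTestFunction Ω g) (p : ℝ≥0∞) :
    MemLp g p (volume.restrict Ω) :=
  hg.1.continuous.memLp_of_hasCompactSupport hg.2.1

theorem IsTestFunction.memLp_fderiv_apply (hg : IsTestFunction Ω g) (p : ℝ≥0∞) (v : ℝ × ℝ) :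
    MemLp (fun x => fderiv ℝ g x v) p (volume.restrict Ω) :=
  (hg.continuous_fderiv_apply v).memLp_of_hasCompactSupport (hg.hasCompactSupport_fderiv_apply v)

theorem IsTestFunction.add {ψ : ℝ × ℝ → E} (hψ : IsTestFunction Ω ψ) (hg : IsTestFunction Ω g) :
    IsTestFunction Ω (fun x => ψ x + g x) :=
  ⟨hψ.1.add hg.1, hψ.2.1.add hg.2.1,
    (tsupport_add ψ g).trans (union_subset hψ.2.2 hg.2.2)⟩

/-- Both integrands vanish off Ω, so this is integration by parts on the whole plane. -/
theorem IsTestFunction.setIntegral_fderiv_smul {ψ : ℝ × ℝ → ℝ} (hψ : IsTestFunction Ω ψ)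
    (hg : IsTestFunction Ω g) (v : ℝ × ℝ) :
    ∫ x in Ω, (fderiv ℝ ψ x v) • g x = -∫ x in Ω, ψ x • fderiv ℝ g x v := by
  have hz : ∀ x, x ∉ Ω → ψ x = 0 := fun x hx =>
    image_eq_zero_of_notMem_tsupport fun h => hx (hψ.2.2 h)
  have hz' : ∀ x, x ∉ Ω → g x = 0 := fun x hx =>
    image_eq_zero_of_notMem_tsupport fun h => hx (hg.2.2 h)
  rw [setIntegral_eq_integral_of_forall_compl_eq_zero (fun x hx => by rw [hz' x hx, smul_zero]),
    setIntegral_eq_integral_of_forall_compl_eq_zero (fun x hx => by rw [hz x hx, zero_smul])]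
  have key := integral_smul_fderiv_eq_neg_fderiv_smul_of_integrable (𝕜 := ℝ) (μ := volume)
    (f := ψ) (g := g) (v := v)
    (((hψ.continuous_fderiv_apply v).smul hg.1.continuous).integrable_of_hasCompactSupport
      hg.2.1.smul_left)
    ((hψ.1.continuous.smul (hg.continuous_fderiv_apply v)).integrable_of_hasCompactSupport
      hψ.2.1.smul_right)
    ((hψ.1.continuous.smul hg.1.continuous).integrable_of_hasCompactSupport hψ.2.1.smul_right)
    (fun x _ => hψ.1.differentiable (by simp) x) (fun x _ => hg.1.differentiable (by simp) x)
  rw [key, neg_neg]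

theorem IsWeakGradient.add_testFunction {G : Fin 2 → ℝ × ℝ → E} (h : IsWeakGradient Ω u G)
    (hu : MemLp u 1 (volume.restrict Ω)) (hG : ∀ j, MemLp (G j) 1 (volume.restrict Ω))
    (hg : IsTestFunction Ω g) :
    IsWeakGradient Ω (fun x => u x + g x)
      ![fun x => G 0 x + fderiv ℝ g x (1, 0), fun x => G 1 x + fderiv ℝ g x (0, 1)] := by
  have i0 : Integrable u (volume.restrict Ω) := memLp_one_iff_integrable.1 hu
  have i1 : ∀ j, Integrable (G j) (volume.restrict Ω) := fun j => memLp_one_iff_integrable.1 (hG j)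
  have i2 : Integrable g (volume.restrict Ω) := memLp_one_iff_integrable.1 (hg.memLp 1)
  have i3 : ∀ v, Integrable (fun x => fderiv ℝ g x v) (volume.restrict Ω) := fun v =>
    memLp_one_iff_integrable.1 (hg.memLp_fderiv_apply 1 v)
  refine ⟨(IntegrableOn.locallyIntegrableOn (i0.add i2)), ?_, fun ψ hψ => ?_⟩
  · intro j
    fin_cases j
    · exact IntegrableOn.locallyIntegrableOn ((i1 0).add (i3 (1, 0)))
    · exact IntegrableOn.locallyIntegrableOn ((i1 1).add (i3 (0, 1)))
  · have key : ∀ (v : ℝ × ℝ) (f : ℝ × ℝ → E), Integrable f (volume.restrict Ω) →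
        ∫ x in Ω, (fderiv ℝ ψ x v) • u x = -∫ x in Ω, ψ x • f x →
        ∫ x in Ω, (fderiv ℝ ψ x v) • (u x + g x) = -∫ x in Ω, ψ x • (f x + fderiv ℝ g x v) := by
      intro v f hf hv
      simp only [smul_add]
      have j0 : IntegrableOn (fun x => fderiv ℝ ψ x v • u x) Ω :=
        i0.smul_of_top_right (hψ.memLp_fderiv_apply ⊤ v)
      have j1 : IntegrableOn (fun x => fderiv ℝ ψ x v • g x) Ω :=
        i2.smul_of_top_right (hψ.memLp_fderiv_apply ⊤ v)
      have j2 : IntegrableOn (fun x => ψ x • f x) Ω := hf.smul_of_top_right (hψ.memLp ⊤)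
      have j3 : IntegrableOn (fun x => ψ x • fderiv ℝ g x v) Ω :=
        (i3 v).smul_of_top_right (hψ.memLp ⊤)
      rw [integral_add j0 j1, integral_add j2 j3, hv, hψ.setIntegral_fderiv_smul hg, neg_add]
    exact ⟨key _ _ (i1 0) (h.2.2 ψ hψ).1, key _ _ (i1 1) (h.2.2 ψ hψ).2⟩

/-- If ψ approximates u in the W^{1,1} norm, then ψ + g approximates u + g with exactly the same
error. -/
theorem MemSobolevInftyZero.add_testFunction (hΩ : volume Ω ≠ ⊤) (hu : MemSobolevInftyZero Ω u)
    (hg : IsTestFunction Ω g) : MemSobolevInftyZero Ω (fun x => u x + g x) := by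
  have : IsFiniteMeasure (volume.restrict Ω) := isFiniteMeasure_restrict.2 hΩ
  obtain ⟨⟨hu1, G, hG, hGp⟩, hu2, G', hG', hGp', hlim⟩ := hu
  refine ⟨⟨hu1.add (hg.memLp ⊤), _, hG.add_testFunction (hu1.mono_exponent le_top)
    (fun j => (hGp j).mono_exponent le_top) hg, ?_⟩, hu2.add (hg.memLp 1), _,
    hG'.add_testFunction hu2 hGp' hg, ?_, fun η hη => ?_⟩
  · intro j
    fin_cases j
    · exact (hGp 0).add (hg.memLp_fderiv_apply ⊤ _)
    · exact (hGp 1).add (hg.memLp_fderiv_apply ⊤ _)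
  · intro j
    fin_cases j
    · exact (hGp' 0).add (hg.memLp_fderiv_apply 1 _)
    · exact (hGp' 1).add (hg.memLp_fderiv_apply 1 _)
  · obtain ⟨ψ, hψ, hlt⟩ := hlim η hη
    refine ⟨_, hψ.add hg, lt_of_eq_of_lt ?_ hlt⟩
    have hd : ∀ x, fderiv ℝ (fun x => ψ x + g x) x = fderiv ℝ ψ x + fderiv ℝ g x := fun x =>
      fderiv_fun_add (hψ.1.differentiable (by simp) x) (hg.1.differentiable (by simp) x)
    simp [hd]

theorem IsPiecewiseC1.add_contDiff (hu : IsPiecewiseC1 Ω u) (hg : ContDiff ℝ 1 g) :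
    IsPiecewiseC1 Ω (fun x => u x + g x) := by
  obtain ⟨G, hG, hd, hv, hC⟩ := hu
  refine ⟨G, hG, hd, hv, fun i => ?_⟩
  obtain ⟨h1, w, D, hw, hD, h2⟩ := hC i
  refine ⟨h1.add hg.contDiffOn, fun x => w x + g x, fun x => D x + fderiv ℝ g x,
    hw.add hg.continuous.continuousOn, hD.add (hg.continuous_fderiv one_ne_zero).continuousOn,
    fun x hx => ⟨congrArg (· + g x) (h2 x hx).1, ?_⟩⟩
  beta_reduce
  rw [(h2 x hx).2, fderiv_fun_add]
  · exact ((h1.contDiffAt ((hG i).1.mem_nhds hx)).differentiableAt one_ne_zero)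
  · exact hg.differentiable one_ne_zero x

end Sobolev

/-! ### Monotonicity of the flux -/

section Flux

variable {α : ℝ≥0} {a : ℝ → ℝ}

theorem flux_neg (a : ℝ → ℝ) (p : ℝ) : flux a (-p) = -flux a p := by
  simp [flux]

/-- σ'(p) is 2z a'(z) + a(z) at z = p², so the sign conditions on a are sign conditions on σ'. -/
theorem hasDerivAt_flux {p : ℝ} (hp : 0 < p) (h : DifferentiableAt ℝ a (p ^ 2)) :
    HasDerivAt (flux a) (2 * p ^ 2 * derivWithin a (Ici 0) (p ^ 2) + a (p ^ 2)) p := by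
  rw [derivWithin_of_mem_nhds (Ici_mem_nhds (by positivity))]
  have h1 : HasDerivAt (fun p => a (p ^ 2)) (deriv a (p ^ 2) * (2 * p)) p := by
    have := HasDerivAt.comp (h₂ := a) (h := fun p : ℝ => p ^ 2) p h.hasDerivAt (hasDerivAt_pow 2 p)
    simpa [Function.comp_def] using this
  refine (h1.mul (hasDerivAt_id p)).congr_deriv ?_
  simp only [id]
  ring

theorem IsDiffusivity.continuousOn (ha : IsDiffusivity α a) : ContinuousOn a (Ici 0) := by
  rcases ha.shape with ⟨h, -⟩ | ⟨-, h, -⟩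
  · exact h.1.continuousOn
  · exact h

theorem IsDiffusivity.continuous_flux (ha : IsDiffusivity α a) : Continuous (flux a) := by
  have : Continuous fun p : ℝ => a (p ^ 2) :=
    ha.continuousOn.comp_continuous (by fun_prop) fun p => sq_nonneg p
  exact this.mul continuous_id

theorem IsDiffusivity.flux_pos (ha : IsDiffusivity α a) {p : ℝ} (hp : 0 < p) : 0 < flux a p :=
  mul_pos (ha.pos _ (sq_nonneg p)) hp

theorem IsDiffusivity.strictMonoOn_flux (ha : IsDiffusivity α a) :
    StrictMonoOn (flux a) (Icc 0 1) := by
  refine strictMonoOn_of_deriv_pos (convex_Icc 0 1) ha.continuous_flux.continuousOn fun p hp => ?_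
  rw [interior_Icc] at hp
  have h1 : p ^ 2 < 1 := by nlinarith [hp.1, hp.2]
  have h0 : 0 < p ^ 2 := by have := hp.1; positivity
  have hd : DifferentiableAt ℝ a (p ^ 2) := by
    rcases ha.shape with ⟨h, -⟩ | ⟨h, -⟩
    · exact (h.1.differentiableOn (by norm_num) _ h0.le).differentiableAt (Ici_mem_nhds h0)
    · exact (h.1.differentiableOn (by norm_num) _ ⟨h0.le, h1⟩).differentiableAt
        (Ico_mem_nhds h0 h1)
  rw [(hasDerivAt_flux hp.1 hd).deriv]
  exact ha.forward _ h0.le h1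

theorem IsDiffusivity.strictAntiOn_flux (ha : IsDiffusivity α a) :
    StrictAntiOn (flux a) (Ici 1) := by
  rcases ha.shape with ⟨h, -, hneg⟩ | ⟨-, -, h⟩
  · refine strictAntiOn_of_deriv_neg (convex_Ici 1) ha.continuous_flux.continuousOn fun p hp => ?_
    rw [interior_Ici] at hp
    have hp : 1 < p := hp
    have h0 : 0 < p ^ 2 := by positivity
    have hd : DifferentiableAt ℝ a (p ^ 2) :=
      (h.1.differentiableOn (by norm_num) _ h0.le).differentiableAt (Ici_mem_nhds h0)
    rw [(hasDerivAt_flux (by linarith) hd).deriv]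
    exact hneg _ (by nlinarith)
  · exact h

end Flux

/-! ### Geometry of the open region -/

section Utilde

variable {σ : ℝ → ℝ} {lam : ℝ}

theorem lt_of_flux_lt (hanti : StrictAntiOn σ (Ici 1)) {p : ℝ} (hp : 1 ≤ p) (hlam : 1 ≤ lam)
    (h : σ lam < σ p) : p < lam := by
  by_contra hcon
  push Not at hcon
  exact h.not_ge (hanti.antitoneOn hlam hp hcon)

theorem isOpen_UtildePlus (hσ : Continuous σ) (hmono : StrictMonoOn σ (Icc 0 1))
    (hanti : StrictAntiOn σ (Ici 1)) (h0 : σ 0 = 0) (hpos : ∀ p, 0 < p → 0 < σ p)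
    (hlam : 1 < lam) : IsOpen (UtildePlus σ lam) := by
  rw [isOpen_iff_mem_nhds]
  rintro ⟨p, q⟩ ⟨h1, h2, pm, pp, k0, k1, k2, k3, k4, k5, k6⟩
  simp only at h1 h2 k3 k4 k5 k6
  -- u and z separate p from the two roots, and σ exceeds q at both. For nearby q' the intermediate
  -- value theorem on [0, u] and [z, λ] gives roots that still enclose p'.
  obtain ⟨u, hu1, hu2⟩ := exists_between (lt_min k1 k5)
  obtain ⟨z, hz1, hz2⟩ := exists_between (max_lt k2 k6)
  rw [lt_min_iff] at hu2
  rw [max_lt_iff] at hz1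
  have hppl : pp < lam := lt_of_flux_lt hanti k2.le hlam.le (by rw [k4]; exact h1)
  have hqu : q < σ u := k3 ▸ hmono ⟨k0.le, k1.le⟩ ⟨(k0.trans hu1).le, hu2.1.le⟩ hu1
  have hqz : q < σ z := k4 ▸ hanti hz1.1.le k2.le hz2
  have hn1 : ∀ᶠ x : ℝ × ℝ in 𝓝 (p, q), u < x.1 ∧ x.1 < z :=
    continuousAt_fst.eventually_mem (Ioo_mem_nhds hu2.2 hz1.2)
  have hn2 : ∀ᶠ x : ℝ × ℝ in 𝓝 (p, q), σ lam < x.2 ∧ x.2 < min (σ u) (σ z) :=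
    continuousAt_snd.eventually_mem (Ioo_mem_nhds h1 (lt_min hqu hqz))
  filter_upwards [hn1, hn2] with x hx hx'
  obtain ⟨hy1, hy2⟩ := lt_min_iff.1 hx'.2
  obtain ⟨m, hm, hmx⟩ := intermediate_value_Ioo (k0.trans hu1).le hσ.continuousOn
    (show x.2 ∈ Ioo (σ 0) (σ u) from ⟨by rw [h0]; exact (hpos _ (by linarith)).trans hx'.1, hy1⟩)
  obtain ⟨n, hn, hnx⟩ := intermediate_value_Ioo' (hz2.trans hppl).le hσ.continuousOn
    (show x.2 ∈ Ioo (σ lam) (σ z) from ⟨hx'.1, hy2⟩)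
  refine ⟨hx'.1, hy1.trans (hmono ⟨(k0.trans hu1).le, hu2.1.le⟩ (by simp) hu2.1), m, n, hm.1,
    hm.2.trans hu2.1, hz1.1.trans hn.1, hmx, hnx, hm.2.trans hx.1, hx.2.trans hn.1⟩

theorem isOpen_UtildeMinus (h : IsOpen (UtildePlus σ lam)) : IsOpen (UtildeMinus σ lam) :=
  h.preimage (f := fun x : ℝ × ℝ => (-x.1, -x.2)) (by fun_prop)

/-- The ends are the two roots of σ = q on the relevant branch. Strict decrease beyond 1 keeps the
outer root below λ, and the negative branch follows by oddness. -/
theorem exists_segment (hodd : ∀ p, σ (-p) = -σ p) (hanti : StrictAntiOn σ (Ici 1))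
    (hlam : 1 < lam) {p q : ℝ} (h : (p, q) ∈ UtildePlus σ lam ∪ UtildeMinus σ lam) :
    ∃ b c : ℝ, b < p ∧ p < c ∧ |b| ≤ lam ∧ |c| ≤ lam ∧ σ b = q ∧ σ c = q ∧
      ∀ x, b < x → x < c → (x, q) ∈ UtildePlus σ lam ∪ UtildeMinus σ lam := by
  rcases h with ⟨h1, h2, pm, pp, k0, k1, k2, k3, k4, k5, k6⟩ |
    ⟨h1, h2, pm, pp, k0, k1, k2, k3, k4, k5, k6⟩
  · have hppl : pp < lam := lt_of_flux_lt hanti k2.le hlam.le (by rw [k4]; exact h1)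
    refine ⟨pm, pp, k5, k6, ?_, ?_, k3, k4, fun x hx hx' =>
      Or.inl ⟨h1, h2, pm, pp, k0, k1, k2, k3, k4, hx, hx'⟩⟩
    · rw [abs_of_pos k0]; linarith
    · rw [abs_of_pos (by linarith)]; linarith
  · have hppl : pp < lam := lt_of_flux_lt hanti k2.le hlam.le (by rw [k4]; exact h1)
    simp only at h1 h2 k3 k4 k5 k6
    refine ⟨-pp, -pm, by linarith, by linarith, ?_, ?_, by rw [hodd, k4, neg_neg],
      by rw [hodd, k3, neg_neg], fun x hx hx' =>
      Or.inr ⟨h1, h2, pm, pp, k0, k1, k2, k3, k4, by simp only; linarith, by simp only; linarith⟩⟩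
    · rw [abs_neg, abs_of_pos (by linarith)]; linarith
    · rw [abs_neg, abs_of_pos k0]; linarith

/-- Points whose first two coordinates are close to the curve `Ktilde`. -/
def nearCurve (σ : ℝ → ℝ) (lam r : ℝ) : Set (ℝ × ℝ × ℝ) :=
  {x | ∃ p, |p| ≤ lam ∧ |x.1 - p| < r ∧ |x.2.1 - σ p| < r}

theorem isOpen_nearCurve (σ : ℝ → ℝ) (lam r : ℝ) : IsOpen (nearCurve σ lam r) := by
  have : nearCurve σ lam r = ⋃ (p : ℝ) (_ : |p| ≤ lam),
      {x : ℝ × ℝ × ℝ | |x.1 - p| < r} ∩ {x : ℝ × ℝ × ℝ | |x.2.1 - σ p| < r} := by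
    ext x
    simp only [nearCurve, mem_iUnion, mem_inter_iff, mem_ofPred_eq, exists_prop]
  rw [this]
  refine isOpen_biUnion fun p _ => (isOpen_lt ?_ continuous_const).inter
    (isOpen_lt ?_ continuous_const)
  · exact (continuous_fst.sub continuous_const).abs
  · exact ((continuous_fst.comp continuous_snd).sub continuous_const).abs

/-- The triples `(v_s, s⁻ᵐ φ_t, v_t)` of matrices in `Uset`. -/
def openRegion (σ : ℝ → ℝ) (lam l₀ : ℝ) : Set (ℝ × ℝ × ℝ) :=
  {x | (x.1, x.2.1) ∈ UtildePlus σ lam ∪ UtildeMinus σ lam ∧ |x.2.2| < l₀}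

theorem isOpen_openRegion (h : IsOpen (UtildePlus σ lam)) (l₀ : ℝ) :
    IsOpen (openRegion σ lam l₀) := by
  have h1 : Continuous fun x : ℝ × ℝ × ℝ => (x.1, x.2.1) := by fun_prop
  have h2 : Continuous fun x : ℝ × ℝ × ℝ => |x.2.2| := by fun_prop
  exact ((h.union (isOpen_UtildeMinus h)).preimage h1).inter (isOpen_lt h2 continuous_const)

theorem exists_segment_openRegion (hodd : ∀ p, σ (-p) = -σ p) (hanti : StrictAntiOn σ (Ici 1))
    (hlam : 1 < lam) {l₀ r s : ℝ} (hr : 0 < r) (hs : 0 < s) {y : ℝ × ℝ × ℝ}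
    (hy : y ∈ openRegion σ lam l₀) :
    ∃ A B : ℝ, 0 < A ∧ 0 < B ∧
      (∀ h ∈ Icc (-A) B, y + (s * h, 0, 0) ∈ openRegion σ lam l₀) ∧
      y + (s * -A, 0, 0) ∈ nearCurve σ lam r ∧ y + (s * B, 0, 0) ∈ nearCurve σ lam r := by
  obtain ⟨b, c, hb, hc, hbl, hcl, hσb, hσc, hbc⟩ := exists_segment hodd hanti hlam hy.1
  -- Only points strictly between b and c are known to lie in the region, so the closed segment
  -- stops short of them by less than r. Dividing by s compensates for the factor s in front of the
  -- profile.
  obtain ⟨b', hb1, hb2⟩ := exists_between (lt_min hb (by linarith : b < b + r))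
  obtain ⟨c', hc1, hc2⟩ := exists_between (max_lt hc (by linarith : c - r < c))
  rw [lt_min_iff] at hb2
  rw [max_lt_iff] at hc1
  have e1 : s * ((y.1 - b') / s) = y.1 - b' := by field_simp
  have e2 : s * ((c' - y.1) / s) = c' - y.1 := by field_simp
  refine ⟨(y.1 - b') / s, (c' - y.1) / s, div_pos (by linarith) hs, div_pos (by linarith) hs,
    fun h hh => ⟨?_, ?_⟩, ⟨b, hbl, ?_, ?_⟩, ⟨c, hcl, ?_, ?_⟩⟩
  · have g1 := mul_le_mul_of_nonneg_left hh.1 hs.le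
    have g2 := mul_le_mul_of_nonneg_left hh.2 hs.le
    rw [mul_neg, e1] at g1
    rw [e2] at g2
    simp only [Prod.fst_add, Prod.snd_add, add_zero]
    exact hbc _ (by linarith) (by linarith)
  · simpa using hy.2
  · rw [mul_neg, e1, Prod.fst_add, abs_lt]
    constructor <;> simp only <;> linarith
  · simpa [hσb] using hr
  · rw [e2, Prod.fst_add, abs_lt]
    constructor <;> simp only <;> linarith
  · simpa [hσc] using hr

end Utilde

/-! ### The distance to the target set -/

section Distance

theorem hsNorm_of (a b c d : ℝ) :
    hsNorm !![a, b; c, d] = Real.sqrt (a ^ 2 + b ^ 2 + c ^ 2 + d ^ 2) := by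
  simp [hsNorm, Fin.sum_univ_two, add_assoc]

theorem hsNorm_nonneg (A : Matrix (Fin 2) (Fin 2) ℝ) : 0 ≤ hsNorm A := Real.sqrt_nonneg _

theorem hsDist_nonneg (A : Matrix (Fin 2) (Fin 2) ℝ) (K : Set (Matrix (Fin 2) (Fin 2) ℝ)) :
    0 ≤ hsDist A K :=
  Real.iInf_nonneg fun _ => hsNorm_nonneg _

theorem hsDist_le {A B : Matrix (Fin 2) (Fin 2) ℝ} {K : Set (Matrix (Fin 2) (Fin 2) ℝ)}
    (hB : B ∈ K) : hsDist A K ≤ hsNorm (A - B) :=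
  ciInf_le (f := fun B : K => hsNorm (A - B)) ⟨0, by rintro _ ⟨_, rfl⟩; exact hsNorm_nonneg _⟩
    ⟨B, hB⟩

theorem hsDist_eq_zero {A : Matrix (Fin 2) (Fin 2) ℝ} {K : Set (Matrix (Fin 2) (Fin 2) ℝ)}
    (hA : A ∈ K) : hsDist A K = 0 :=
  le_antisymm ((hsDist_le hA).trans (by simp [hsNorm])) (hsDist_nonneg _ _)

variable {σ : ℝ → ℝ} {m : ℕ} {lam l₀ : ℝ}

/-- The competitor copies l and sᵐ v, so the difference is diagonal and its norm is at most the sum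
of its two entries in absolute value. -/
theorem hsDist_Kset_le {s v p q l p' : ℝ} (hs : 0 ≤ s) (hl : |l| ≤ l₀) (hp' : |p'| ≤ lam) :
    hsDist !![p, l; s ^ m * v, s ^ m * q] (Kset σ m lam l₀ s v) ≤
      |p - p'| + s ^ m * |q - σ p'| := by
  have hB : !![p', l; s ^ m * v, s ^ m * σ p'] ∈ Kset σ m lam l₀ s v :=
    ⟨p', σ p', l, ⟨hp', rfl⟩, hl, rfl⟩
  refine (hsDist_le hB).trans ?_
  have e : !![p, l; s ^ m * v, s ^ m * q] - !![p', l; s ^ m * v, s ^ m * σ p'] =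
      !![p - p', 0; 0, s ^ m * (q - σ p')] := by
    ext i j
    fin_cases i <;> fin_cases j <;> simp [mul_sub]
  have hsm : 0 ≤ s ^ m := by positivity
  rw [e, hsNorm_of]
  refine Real.sqrt_le_iff.2 ⟨by positivity, ?_⟩
  have h1 : 0 ≤ |p - p'| * (s ^ m * |q - σ p'|) := by positivity
  have h2 := sq_abs (p - p')
  have h3 := sq_abs (q - σ p')
  calc _ = |p - p'| ^ 2 + (s ^ m) ^ 2 * |q - σ p'| ^ 2 := by rw [h2, h3]; ring
    _ ≤ _ := by nlinarith

/-- Indexed by (p, l), the infimum runs over a set independent of y, and each term is continuous in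
y. The infimum is therefore upper semicontinuous, with no regularity of σ needed. -/
theorem measurable_hsDist_Kset (hlam : 0 ≤ lam) (hl₀ : 0 ≤ l₀) :
    Measurable fun y : ℝ × ℝ × ℝ × ℝ × ℝ × ℝ =>
      hsDist !![y.1, y.2.1; y.2.2.1, y.2.2.2.1]
        (Kset σ m lam l₀ y.2.2.2.2.1 y.2.2.2.2.2) := by
  let ι := {x : ℝ × ℝ // |x.1| ≤ lam ∧ |x.2| ≤ l₀}
  have : Nonempty ι := ⟨⟨(0, 0), by simpa using hlam, by simpa using hl₀⟩⟩
  have e : ∀ y : ℝ × ℝ × ℝ × ℝ × ℝ × ℝ, hsDist !![y.1, y.2.1; y.2.2.1, y.2.2.2.1]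
      (Kset σ m lam l₀ y.2.2.2.2.1 y.2.2.2.2.2) =
      ⨅ i : ι, Real.sqrt ((y.1 - i.1.1) ^ 2 + (y.2.1 - i.1.2) ^ 2 +
        (y.2.2.1 - y.2.2.2.2.1 ^ m * y.2.2.2.2.2) ^ 2 +
        (y.2.2.2.1 - y.2.2.2.2.1 ^ m * σ i.1.1) ^ 2) := by
    intro y
    let G : ι → Kset σ m lam l₀ y.2.2.2.2.1 y.2.2.2.2.2 := fun i =>
      ⟨!![i.1.1, i.1.2; y.2.2.2.2.1 ^ m * y.2.2.2.2.2, y.2.2.2.2.1 ^ m * σ i.1.1],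
        i.1.1, σ i.1.1, i.1.2, ⟨i.2.1, rfl⟩, i.2.2, rfl⟩
    have hG : Function.Surjective G := by
      rintro ⟨_, p, q, l, ⟨hp, hq⟩, hl, rfl⟩
      simp only at hp hq
      subst hq
      exact ⟨⟨(p, l), hp, hl⟩, rfl⟩
    rw [hsDist, ← hG.iInf_comp]
    refine iInf_congr fun i => ?_
    rw [← hsNorm_of]
    congr 1
    ext i j
    fin_cases i <;> fin_cases j <;> simp [G]
  simp only [e]
  refine UpperSemicontinuous.measurable (upperSemicontinuous_ciInf (fun y => ⟨0, ?_⟩) fun i => ?_)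
  · rintro _ ⟨i, rfl⟩
    exact Real.sqrt_nonneg _
  · refine Continuous.upperSemicontinuous ?_
    fun_prop

end Distance

/-! ### Vector-valued perturbations, measurability and the integral bound -/

/-- The map `x ↦ (w x, f x)` into the Euclidean plane. -/
noncomputable def pairMap (w f : ℝ × ℝ → ℝ) (x : ℝ × ℝ) : EuclideanSpace ℝ (Fin 2) :=
  !₂[w x, f x]

theorem contDiff_pairMap {w f : ℝ × ℝ → ℝ} (hw : ContDiff ℝ ∞ w) (hf : ContDiff ℝ ∞ f) :
    ContDiff ℝ ∞ (pairMap w f) := by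
  refine contDiff_euclidean.2 fun i => ?_
  fin_cases i
  · exact hw
  · exact hf

theorem hasFDerivAt_apply {Φ : ℝ × ℝ → EuclideanSpace ℝ (Fin 2)} {x : ℝ × ℝ}
    (h : DifferentiableAt ℝ Φ x) (i : Fin 2) :
    HasFDerivAt (fun y => Φ y i) ((EuclideanSpace.proj i).comp (fderiv ℝ Φ x)) x :=
  (EuclideanSpace.proj (𝕜 := ℝ) i).hasFDerivAt.comp x h.hasFDerivAt

theorem norm_pairMap_le (w f : ℝ × ℝ → ℝ) (x : ℝ × ℝ) : ‖pairMap w f x‖ ≤ |w x| + |f x| := by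
  rw [EuclideanSpace.norm_eq, Fin.sum_univ_two]
  refine Real.sqrt_le_iff.2 ⟨by positivity, ?_⟩
  have : 0 ≤ |w x| * |f x| := by positivity
  change |w x| ^ 2 + |f x| ^ 2 ≤ _
  nlinarith

/-- The effect on `grad` of adding a smooth pair `(w, f)` with `f_s = s ^ m w`. -/
theorem grad_add_pairMap {Φ : ℝ × ℝ → EuclideanSpace ℝ (Fin 2)} {w f : ℝ × ℝ → ℝ} {x : ℝ × ℝ}
    (hΦ : DifferentiableAt ℝ Φ x) (hw : ContDiff ℝ ∞ w) (hf : ContDiff ℝ ∞ f) {a b c d : ℝ}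
    (hw' : HasFDerivAt w (a • ContinuousLinearMap.fst ℝ ℝ ℝ + b • ContinuousLinearMap.snd ℝ ℝ ℝ) x)
    (hf' : HasFDerivAt f
      (c • ContinuousLinearMap.fst ℝ ℝ ℝ + d • ContinuousLinearMap.snd ℝ ℝ ℝ) x) :
    grad (fun y => Φ y + pairMap w f y) x = grad Φ x + !![a, b; c, d] := by
  have hg : DifferentiableAt ℝ (pairMap w f) x :=
    (contDiff_pairMap hw hf).differentiable (by simp) x
  have e0 := (hasFDerivAt_apply hg 0).unique hw'
  have e1 := (hasFDerivAt_apply hg 1).unique hf'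
  have e00 := congrArg (fun T => T (1, 0)) e0
  have e01 := congrArg (fun T => T (0, 1)) e0
  have e10 := congrArg (fun T => T (1, 0)) e1
  have e11 := congrArg (fun T => T (0, 1)) e1
  simp at e00 e01 e10 e11
  ext i j
  fin_cases i <;> fin_cases j <;> simp [grad, fderiv_fun_add hΦ hg, *]

theorem measurable_grad_entry (Φ : ℝ × ℝ → EuclideanSpace ℝ (Fin 2)) (v : ℝ × ℝ) (i : Fin 2) :
    Measurable fun x => fderiv ℝ Φ x v i :=
  (EuclideanSpace.proj (𝕜 := ℝ) i).continuous.measurable.comp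
    (measurable_fderiv_apply_const ℝ Φ v)

theorem aestronglyMeasurable_hsDist_grad {σ : ℝ → ℝ} {m : ℕ} {lam l₀ : ℝ} (hlam : 0 ≤ lam)
    (hl₀ : 0 ≤ l₀) {Ψ : ℝ × ℝ → EuclideanSpace ℝ (Fin 2)} {μ : Measure (ℝ × ℝ)}
    (hΨ : AEStronglyMeasurable Ψ μ) :
    AEStronglyMeasurable (fun x => hsDist (grad Ψ x) (Kset σ m lam l₀ x.1 (Ψ x 0))) μ := by
  have h0 : AEMeasurable (fun x => Ψ x 0) μ :=
    (EuclideanSpace.proj (𝕜 := ℝ) (0 : Fin 2)).continuous.measurable.comp_aemeasurable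
      hΨ.aemeasurable
  have h := (measurable_hsDist_Kset (σ := σ) (m := m) hlam hl₀).comp_aemeasurable
    ((measurable_grad_entry Ψ (1, 0) 0).aemeasurable.prodMk
    ((measurable_grad_entry Ψ (0, 1) 0).aemeasurable.prodMk
    ((measurable_grad_entry Ψ (1, 0) 1).aemeasurable.prodMk
    ((measurable_grad_entry Ψ (0, 1) 1).aemeasurable.prodMk
    (measurable_fst.aemeasurable.prodMk h0)))))
  exact h.aestronglyMeasurable

theorem volume_Jstar (R T δ₀ : ℝ) :
    volume (Jstar R T δ₀) = ENNReal.ofReal (R - δ₀ - δ₀) * ENNReal.ofReal (T - 0) := by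
  rw [Jstar, Measure.volume_eq_prod, Measure.prod_prod, Real.volume_Ioo, Real.volume_Ioo]

theorem isOpen_Jstar (R T δ₀ : ℝ) : IsOpen (Jstar R T δ₀) := isOpen_Ioo.prod isOpen_Ioo

/-- Bounding an integral by a small function plus a bounded function on a small set. -/
theorem integrableOn_and_setIntegral_le {Ω bad : Set (ℝ × ℝ)} {d : ℝ × ℝ → ℝ} {c M δ : ℝ}
    (hΩ : volume Ω ≠ ⊤) (hd : AEStronglyMeasurable d (volume.restrict Ω)) (hd0 : ∀ x, 0 ≤ d x)
    (hc : 0 ≤ c) (hM : 0 ≤ M) (hδ : 0 ≤ δ) (hbad : volume bad ≤ ENNReal.ofReal δ)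
    (h : ∀ᵐ x ∂(volume.restrict Ω), d x ≤ M ∧ (x ∉ bad → d x ≤ c)) :
    IntegrableOn d Ω ∧ ∫ x in Ω, d x ≤ c * volume.real Ω + M * δ := by
  have : IsFiniteMeasure (volume.restrict Ω) := isFiniteMeasure_restrict.2 hΩ
  -- The bad set need not be measurable; its measurable hull has the same measure.
  set B := toMeasurable volume bad with hB
  have hBm : MeasurableSet B := measurableSet_toMeasurable _ _
  have hdom : Integrable (fun x => c + B.indicator (fun _ => M) x) (volume.restrict Ω) :=
    (integrable_const c).add ((integrable_const M).indicator hBm)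
  have hle : ∀ᵐ x ∂(volume.restrict Ω), d x ≤ c + B.indicator (fun _ => M) x := by
    filter_upwards [h] with x hx
    by_cases hxB : x ∈ B
    · rw [indicator_of_mem hxB]; linarith [hx.1]
    · rw [indicator_of_notMem hxB, add_zero]
      exact hx.2 fun hb => hxB (subset_toMeasurable _ _ hb)
  have hint : IntegrableOn d Ω := hdom.mono' hd (by
    filter_upwards [hle] with x hx
    rwa [Real.norm_of_nonneg (hd0 x)])
  refine ⟨hint, (integral_mono_ae hint hdom hle).trans ?_⟩
  have hBv : (volume.restrict Ω).real B ≤ δ := by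
    refine ENNReal.toReal_le_of_le_ofReal hδ ?_
    refine (Measure.restrict_apply_le _ _).trans ?_
    rwa [hB, measure_toMeasurable]
  rw [integral_add (integrable_const c) ((integrable_const M).indicator hBm),
    integral_indicator_const _ hBm, integral_const]
  simp only [measureReal_restrict_apply_univ, smul_eq_mul]
  rw [mul_comm (volume.real Ω), mul_comm _ M]
  gcongr

end PeronaMalik

/-! ### The density theorem -/

open PeronaMalik
theorem mainTheorem2 (α : ℝ≥0) (a : ℝ → ℝ) (ha : IsDiffusivity α a)
    (m : ℕ) (lam : ℝ) (hlam : 1 < lam) (l₀ : ℝ) (hl₀ : 0 < l₀)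
    (R T δ₀ : ℝ) (hR : 0 < R) (hT : 0 < T) (hδ₀ : 0 < δ₀) (hδ₀R : δ₀ < R / 2)
    (Φstar : ℝ × ℝ → EuclideanSpace ℝ (Fin 2))
    (hΦstar : MemSobolev ∞ (Jstar R T δ₀) Φstar)
    (hΦstarC1 : IsPiecewiseC1 (Jstar R T δ₀) Φstar)
    (ε : ℝ) (hε : 0 < ε) :
    ∀ Φ ∈ admissible (flux a) m lam l₀ (Jstar R T δ₀) Φstar, ∀ η : ℝ, 0 < η →
      ∃ Ψ ∈ admissibleEps (flux a) m lam l₀ (Jstar R T δ₀) Φstar ε,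
        eLpNorm (fun x => Φ x - Ψ x) ∞ (volume.restrict (Jstar R T δ₀)) < ENNReal.ofReal η := by
  rintro Φ ⟨hΦ0, hΦC1, hΦae⟩ η hη
  set Ω := Jstar R T δ₀ with hΩdef
  have hΩo : IsOpen Ω := isOpen_Jstar R T δ₀
  have hΩfin : volume Ω ≠ ⊤ := by
    rw [hΩdef, volume_Jstar]
    exact ENNReal.mul_ne_top ENNReal.ofReal_ne_top ENNReal.ofReal_ne_top
  have hΩpos : 0 < volume.real Ω := by
    rw [measureReal_def, hΩdef, volume_Jstar, ENNReal.toReal_mul,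
      ENNReal.toReal_ofReal (by linarith), ENNReal.toReal_ofReal (by linarith)]
    exact mul_pos (by linarith) (by linarith)
  have hΩs : ∀ x ∈ Ω, 0 < x.1 ∧ x.1 ≤ R := fun x hx =>
    ⟨hδ₀.trans hx.1.1, by linarith [hx.1.2]⟩
  set σ := flux a with hσ
  have hanti : StrictAntiOn σ (Ici 1) := ha.strictAntiOn_flux
  have hodd : ∀ p, σ (-p) = -σ p := flux_neg a
  have hUo : IsOpen (UtildePlus σ lam) := isOpen_UtildePlus ha.continuous_flux
    ha.strictMonoOn_flux hanti (show flux a 0 = 0 by simp [flux]) (fun p => ha.flux_pos) hlam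
  have hWo := isOpen_openRegion hUo l₀
  obtain ⟨G, hG, -, hGnull, hGC⟩ := id hΦC1
  set U := ⋃ i, G i with hU
  have hUopen : IsOpen U := isOpen_iUnion fun i => (hG i).1
  have hUΩ : U ⊆ Ω := iUnion_subset fun i => (hG i).2
  have hΦU : ContDiffOn ℝ 1 Φ U := by
    intro x hx
    obtain ⟨i, hi⟩ := mem_iUnion.1 hx
    exact ((hGC i).1.contDiffAt ((hG i).1.mem_nhds hi)).contDiffWithinAt
  have hΦdiff : ∀ x ∈ U, DifferentiableAt ℝ Φ x := fun x hx =>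
    (hΦU.contDiffAt (hUopen.mem_nhds hx)).differentiableAt one_ne_zero
  have hdΦ : ContinuousOn (fderiv ℝ Φ) U := hΦU.continuousOn_fderiv_of_isOpen hUopen le_rfl
  set F : ℝ × ℝ → ℝ × ℝ × ℝ := fun x =>
    (fderiv ℝ Φ x (1, 0) 0, fderiv ℝ Φ x (0, 1) 1 / x.1 ^ m, fderiv ℝ Φ x (0, 1) 0) with hF
  have hFU : ContinuousOn F U := by
    have hent : ∀ (v : ℝ × ℝ) (i : Fin 2), ContinuousOn (fun x => fderiv ℝ Φ x v i) U :=
      fun v i => (EuclideanSpace.proj (𝕜 := ℝ) i).continuous.comp_continuousOn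
        (hdΦ.clm_apply continuousOn_const)
    refine (hent _ _).prodMk (((hent _ _).div (by fun_prop) fun x hx => ?_).prodMk (hent _ _))
    exact pow_ne_zero _ (hΩs x (hUΩ hx)).1.ne'
  -- The set to be modified. It is open because F is continuous on U and the region is open.
  set V := U ∩ F ⁻¹' openRegion σ lam l₀ with hV
  have hVo : IsOpen V := hFU.isOpen_inter_preimage hUopen hWo
  have hVU : V ⊆ U := inter_subset_left
  have hVΩ : V ⊆ Ω := hVU.trans hUΩ
  -- Distance r to the curve in both coordinates costs at most r + Rᵐ r = ε/2 in the matrix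
  -- distance.
  set r := ε / (2 * (1 + R ^ m)) with hr
  have hr0 : 0 < r := by positivity
  -- The first bound gives a displacement of at most 2δ ≤ η/2; the second makes the contribution 2λδ
  -- of the bad set at most ε|Ω|/2.
  set δ := min (η / 4) (ε * volume.real Ω / (4 * lam)) with hδdef
  have hlam0 : 0 < lam := by linarith
  have hδ0 : 0 < δ := lt_min (by positivity) (by positivity)
  obtain ⟨w, f, ws, wt, q, C, bad, hw, hf, hC, hCV, hCz, hwf, hder, hWmem, hbad, hNmem⟩ :=
    exists_oscillation hVo (measure_ne_top_of_subset hVΩ hΩfin) m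
      (fun x hx => hΩs x (hVΩ hx)) (hFU.mono hVU) hWo (isOpen_nearCurve σ lam r)
      (fun x hx => exists_segment_openRegion hodd hanti hlam hr0 (hΩs x (hVΩ hx)).1 hx.2) hδ0
  set g := pairMap w f with hg
  have hgC : ∀ x ∉ C, g x = 0 := by
    intro x hx
    ext i
    fin_cases i
    · exact (hCz x hx).1
    · exact (hCz x hx).2
  have hgsupp : tsupport g ⊆ C :=
    closure_minimal (fun x hx => by_contra fun h => hx (hgC x h)) hC.isClosed
  have hgtest : IsTestFunction Ω g :=
    ⟨contDiff_pairMap hw hf, hC.of_isClosed_subset (isClosed_tsupport g) hgsupp,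
      hgsupp.trans (hCV.trans hVΩ)⟩
  set Ψ : ℝ × ℝ → EuclideanSpace ℝ (Fin 2) := fun x => Φ x + g x with hΨ
  have hUae : ∀ᵐ x ∂(volume.restrict Ω), x ∈ U := by
    rw [ae_restrict_iff' hΩo.measurableSet]
    have : volume (Ω \ U) = 0 := hGnull
    filter_upwards [measure_eq_zero_iff_ae_notMem.1 this] with x hx hxΩ
    exact by_contra fun h => hx ⟨hxΩ, h⟩
  have key : ∀ᵐ x ∂(volume.restrict Ω),
      grad Ψ x ∈ Kset σ m lam l₀ x.1 (Ψ x 0) ∪ Uset σ m lam l₀ x.1 (Ψ x 0) ∧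
      hsDist (grad Ψ x) (Kset σ m lam l₀ x.1 (Ψ x 0)) ≤ 2 * lam ∧
      (x ∉ bad → hsDist (grad Ψ x) (Kset σ m lam l₀ x.1 (Ψ x 0)) ≤ ε / 2) := by
    filter_upwards [hUae, hΦae] with x hxU hx
    obtain ⟨hs0, hsR⟩ := hΩs x (hUΩ hxU)
    have hsm : x.1 ^ m ≠ 0 := pow_ne_zero _ hs0.ne'
    by_cases hxV : x ∈ V
    · have hΦs : fderiv ℝ Φ x (1, 0) 1 = x.1 ^ m * Φ x 0 := by
        rcases hx with ⟨p, q, l, -, -, h⟩ | ⟨p, q, l, -, -, h⟩ <;>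
        · have := congrFun (congrFun h 1) 0
          simpa [grad] using this
      have hgrad : grad Ψ x = !![(F x + (ws x, q x, wt x)).1, (F x + (ws x, q x, wt x)).2.2;
          x.1 ^ m * Ψ x 0, x.1 ^ m * (F x + (ws x, q x, wt x)).2.1] := by
        rw [hΨ, hg, grad_add_pairMap (hΦdiff x hxU) hw hf (hder x).1 (hder x).2]
        ext i j
        fin_cases i <;> fin_cases j <;> simp [grad, hF, hΦs, pairMap, mul_add]
        field_simp
      have hmem := hWmem x hxV
      obtain ⟨b, c, hb, hc, hbl, hcl, hσb, hσc, -⟩ := exists_segment hodd hanti hlam hmem.1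
      rw [hgrad]
      refine ⟨Or.inr ⟨_, _, _, hmem.1, hmem.2, rfl⟩, ?_, fun hxb => ?_⟩
      -- Compare with the left end b of the horizontal segment: the flux coordinates agree, and p -
      -- b < c - b ≤ 2λ.
      · refine (hsDist_Kset_le hs0.le hmem.2.le hbl).trans ?_
        rw [hσb, sub_self, abs_zero, mul_zero, add_zero, abs_of_pos (by linarith)]
        linarith [(abs_le.1 hbl).1, (abs_le.1 hcl).2]
      · obtain ⟨p', hp', h1, h2⟩ := hNmem x ⟨hxV, hxb⟩
        refine (hsDist_Kset_le hs0.le hmem.2.le hp').trans ?_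
        calc _ ≤ r + R ^ m * r := by gcongr
          _ = ε / 2 := by rw [hr]; field_simp
    · have hxC : x ∉ C := fun h => hxV (hCV h)
      have hg0 : g x = 0 := hgC x hxC
      have hgrad : grad Ψ x = grad Φ x := by
        have h1 : Ψ =ᶠ[𝓝 x] Φ := by
          filter_upwards [hC.isClosed.isOpen_compl.mem_nhds hxC] with y hy
          rw [hΨ]
          simp [hgC y hy]
        rw [grad, grad, h1.fderiv_eq]
      have hΨx : Ψ x = Φ x := by simp [hΨ, hg0]
      rw [hgrad, hΨx]
      rcases hx with hx | ⟨p, q, l, hpq, hl, h⟩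
      · rw [hsDist_eq_zero hx]
        exact ⟨Or.inl hx, by linarith, fun _ => by linarith⟩
      -- A point of U with gradient in `Uset` would belong to V, so off V only `Kset` remains.
      · refine absurd ⟨hxU, ?_⟩ hxV
        have h00 := congrFun (congrFun h 0) 0
        have h01 := congrFun (congrFun h 0) 1
        have h11 := congrFun (congrFun h 1) 1
        simp [grad] at h00 h01 h11
        have : F x = (p, q, l) := by
          simp only [hF, h00, h01, h11]
          rw [mul_div_cancel_left₀ _ hsm]
        rw [mem_preimage, this]
        exact ⟨hpq, hl⟩
  have hΨmeas : AEStronglyMeasurable Ψ (volume.restrict Ω) := by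
    -- Measurability of Φ is recovered from Φ = (Φ - Φstar) + Φstar.
    have h1 := (hΦ0.1.1.aestronglyMeasurable.add hΦstar.1.aestronglyMeasurable).add
      hgtest.1.continuous.aestronglyMeasurable
    refine h1.congr (Eventually.of_forall fun x => ?_)
    simp [hΨ]
  obtain ⟨hint, hle⟩ := integrableOn_and_setIntegral_le hΩfin
    (aestronglyMeasurable_hsDist_grad (σ := σ) (m := m) hlam0.le hl₀.le hΨmeas)
    (fun x => hsDist_nonneg _ _) (by positivity : 0 ≤ ε / 2) (by positivity : 0 ≤ 2 * lam)
    hδ0.le hbad (key.mono fun x hx => hx.2)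
  refine ⟨Ψ, ⟨⟨?_, hΦC1.add_contDiff (hgtest.1.of_le (by simp)), key.mono fun x hx => hx.1⟩, hint,
    hle.trans ?_⟩, ?_⟩
  · have := hΦ0.add_testFunction hΩfin hgtest
    refine (funext fun x => ?_ : _ = fun x => Ψ x - Φstar x) ▸ this
    simp only [hΨ]
    abel
  · have : 2 * lam * δ ≤ ε * volume.real Ω / 2 := by
      calc 2 * lam * δ ≤ 2 * lam * (ε * volume.real Ω / (4 * lam)) := by
            gcongr; exact min_le_right _ _
        _ = ε * volume.real Ω / 2 := by field_simp; ring
    linarith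
  · have hbound : ∀ x, ‖Φ x - Ψ x‖ ≤ η / 2 := by
      intro x
      have h1 : Φ x - Ψ x = -g x := by simp [hΨ]
      rw [h1, norm_neg]
      refine (norm_pairMap_le w f x).trans ?_
      linarith [(hwf x).1, (hwf x).2, min_le_left (η / 4) (ε * volume.real Ω / (4 * lam))]
    rw [eLpNorm_exponent_top]
    refine (eLpNormEssSup_le_of_ae_bound (Eventually.of_forall hbound)).trans_lt ?_
    exact (ENNReal.ofReal_lt_ofReal_iff hη).2 (by linarith)
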